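/- Fix the Fourier transform $\mathcal F f(\xi)=\int_{\mathbb R^d} f(x)e^{-2\pi i x\cdot\xi}\,dx$ on $\mathcal S(\mathbb R^d)$, extended to $\mathcal S'(\mathbb R^d)$ by duality. For $1\le p\le u<\infty$ and a locally integrable $g$ put $$\|g\,|\,\mathcal M^u_p(\mathbb R^d)\| = \sup_{y\in\mathbb R^d,\ r>0} |B(y,r)|^{\frac1u-\frac1p}\Big(\int_{B(y,r)}|g(x)|^p\,dx\Big)^{1/p}\in[0,\infty].$$ Let $\varphi_0\in C_0^\infty(\mathbb R^d)$ be non-negative with $\varphi_0(x)=1$ for $|x|\le1$ and $\varphi_0(x)=0$ for $|x|\ge 3/2$, and put $\varphi_k(x)=\varphi_0(2^{-k}x)-\varphi_0(2^{-k+1}x)$ for $k\ge1$; call $(\varphi_k)_{k\ge0}$ a smooth dyadic decomposition of unity. For $s>0$ and $1\le q\le\infty$ the real Besov-Morrey space $\mathbb N^s_{u,p,q}(\mathbb R^d)$ is the set of all real-valued $f\in L_1^{loc}(\mathbb R^d)\cap\mathcal S'(\mathbb R^d)$ such that $$\|f\,|\,\mathcal N^s_{u,p,q}(\mathbb R^d)\|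 = \Big(\sum_{k=0}^\infty 2^{ksq}\,\big\|\mathcal F^{-1}[\varphi_k\mathcal F f]\,\big|\,\mathcal M^u_p(\mathbb R^d)\big\|^q\Big)^{1/q}<\infty,$$ with $\sup_k 2^{ks}\|\mathcal F^{-1}[\varphi_k\mathcal F f]\,|\,\mathcal M^u_p(\mathbb R^d)\|$ in place of the sum if $q=\infty$. **Proposition.** Let $d\ge1$ be an integer, $1\le p\le u<\infty$, $1\le q\le\infty$ and $s\in\mathbb R$, and suppose that one of the following holds: (i) $s>\min\big(1+\frac1p,\,1+\frac du\big)$; (ii) $s=\min\big(1+\frac1p,\,1+\frac du\big)$ and $q\ne\infty$; (iii) $d=1$, $s=1+\frac1u$ and $q=\infty$. Then there is a function $f:\mathbb R^d\to\mathbb R$ such that, for every smooth dyadic decomposition of unity, $f\in\mathbb N^s_{u,p,q}(\mathbb R^d)$, but $|f|\notin\mathbb N^s_{u,p,q}(\mathbb R^d)$ and $\max(f,0)\notin\mathbb N^s_{u,p,q}(\mathbb R^d)$. -/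

import Mathlib

open MeasureTheory
open scoped ENNReal SchwartzMap

namespace BesovMorrey

/-- The Morrey norm
`sup_{y, r > 0} |B(y,r)|^(1/u - 1/p) * (∫_{B(y,r)} |g|^p)^(1/p)`, with values in `[0, ∞]`. -/
noncomputable def morreyNorm {d : ℕ} (p u : ℝ) (g : EuclideanSpace ℝ (Fin d) → ℂ) : ℝ≥0∞ :=
  ⨆ (y : EuclideanSpace ℝ (Fin d)) (r : ℝ) (_ : 0 < r),
    volume (Metric.ball y r) ^ (1 / u - 1 / p) *
      (∫⁻ x in Metric.ball y r, ‖g x‖ₑ ^ p) ^ (1 / p)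

/-- The tempered distribution `T` is (given by) the locally integrable function `g`:
`T φ = ∫ φ g` for all test functions `φ` (smooth with compact support). Since test functions are
dense in the Schwartz space, `T` is determined by `g`; and `g` is determined by `T` up to a null
set. -/
def Represents {d : ℕ} (T : 𝓢'(EuclideanSpace ℝ (Fin d), ℂ))
    (g : EuclideanSpace ℝ (Fin d) → ℂ) : Prop :=
  LocallyIntegrable g volume ∧
    ∀ φ : 𝓢(EuclideanSpace ℝ (Fin d), ℂ), HasCompactSupport (φ : EuclideanSpace ℝ (Fin d) → ℂ) →
      T φ = ∫ x, φ x * g x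

/-- The Morrey norm of a tempered distribution: the Morrey norm of the locally integrable function
that represents it (all representatives agree almost everywhere, hence have the same norm), and `∞`
if there is none. -/
noncomputable def distMorreyNorm {d : ℕ} (p u : ℝ)
    (T : 𝓢'(EuclideanSpace ℝ (Fin d), ℂ)) : ℝ≥0∞ :=
  ⨅ (g : EuclideanSpace ℝ (Fin d) → ℂ) (_ : Represents T g), morreyNorm p u g

/-- `φ₀` generates a smooth dyadic decomposition of unity: it is smooth, non-negative, equal to `1`
on the closed unit ball, and it vanishes where `|x| ≥ 3/2`. -/
structure IsDyadicGenerator {d : ℕ} (φ₀ : EuclideanSpace ℝ (Fin d) → ℝ) : Prop where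
  contDiff : ContDiff ℝ (⊤ : ℕ∞) φ₀
  nonneg : ∀ x, 0 ≤ φ₀ x
  eq_one : ∀ x, ‖x‖ ≤ 1 → φ₀ x = 1
  eq_zero : ∀ x, 3 / 2 ≤ ‖x‖ → φ₀ x = 0

/-- The smooth dyadic decomposition of unity generated by `φ₀`: `φ_0 = φ₀` and
`φ_k(x) = φ₀(2^(-k) x) - φ₀(2^(-k+1) x)` for `k ≥ 1`. -/
noncomputable def dyadicPiece {d : ℕ} (φ₀ : EuclideanSpace ℝ (Fin d) → ℝ) :
    ℕ → EuclideanSpace ℝ (Fin d) → ℝ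
  | 0 => φ₀
  | k + 1 => fun x => φ₀ (((2 : ℝ) ^ (k + 1))⁻¹ • x) - φ₀ (((2 : ℝ) ^ k)⁻¹ • x)

/-- The tempered distribution `𝓕⁻¹[φ_k 𝓕 T]`. -/
noncomputable def littlewoodPaleyPiece {d : ℕ} (φ₀ : EuclideanSpace ℝ (Fin d) → ℝ)
    (T : 𝓢'(EuclideanSpace ℝ (Fin d), ℂ)) (k : ℕ) : 𝓢'(EuclideanSpace ℝ (Fin d), ℂ) :=
  TemperedDistribution.fourierMultiplierCLM ℂ (fun ξ => (dyadicPiece φ₀ k ξ : ℂ)) T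

/-- The Besov-Morrey norm
`(∑_k (2^(k s) * ‖𝓕⁻¹[φ_k 𝓕 T]‖_{M^u_p})^q)^(1/q)` of a tempered distribution, with values in
`[0, ∞]`, and with the supremum over `k` in place of the sum if `q = ∞`. -/
noncomputable def besovMorreyNorm {d : ℕ} (φ₀ : EuclideanSpace ℝ (Fin d) → ℝ) (s u p : ℝ)
    (q : ℝ≥0∞) (T : 𝓢'(EuclideanSpace ℝ (Fin d), ℂ)) : ℝ≥0∞ :=
  if q = ∞ then
    ⨆ k : ℕ, (2 : ℝ≥0∞) ^ ((k : ℝ) * s) * distMorreyNorm p u (littlewoodPaleyPiece φ₀ T k)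
  else
    (∑' k : ℕ, ((2 : ℝ≥0∞) ^ ((k : ℝ) * s) *
      distMorreyNorm p u (littlewoodPaleyPiece φ₀ T k)) ^ q.toReal) ^ (1 / q.toReal)

/-- The real-valued function `f` belongs to the real Besov-Morrey space `𝔑^s_{u,p,q}(ℝ^d)`, the
norm being formed with the decomposition of unity generated by `φ₀`: `f` is locally integrable, it
is a tempered distribution, and its Besov-Morrey norm is finite. -/
def MemBesovMorrey {d : ℕ} (φ₀ : EuclideanSpace ℝ (Fin d) → ℝ) (s u p : ℝ) (q : ℝ≥0∞)
    (f : EuclideanSpace ℝ (Fin d) → ℝ) : Prop :=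
  ∃ T : 𝓢'(EuclideanSpace ℝ (Fin d), ℂ),
    Represents T (fun x => (f x : ℂ)) ∧ besovMorreyNorm φ₀ s u p q T < ∞

end BesovMorrey

/-! The maps `|·|` and `max · 0` are both positively homogeneous with a kink at `0` (`IsKink`);
applied to a smooth function with a simple zero across a hyperplane, they create a kink along it,
and the kink limits smoothness measured in Morrey norms.

In cases (i) and (ii) take `f x = x₀ g(x₀) ∏ g(xᵢ)` with `g ≥ 0` band-limited. Then `f` is
band-limited, so only its zeroth Littlewood-Paley piece survives and `f` lies in every space of the
scale. Since `g ≥ 0`, `κ (f x) = κ(x₀) g(x₀) ∏ g(xᵢ)`. It is paired with a test function of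
frequency about `2^k` in direction `e₀`, concentrated on a box of width `2^(-k)` in `x₀` and
`2^(-l)` in the other directions. The second derivative of `κ` is a nonzero multiple of the Dirac
mass at `0`, so this pairing has size about `2^(-k)`. A Hölder inequality bounds it above by
`2^((k-l)/p + l d/u)` times the Morrey norm of the `k`-th piece (`exists_test_lower_bound`). Taking
`l` bounded or `l = k` gives `2^(k m) * norm ≥ c` with `m = min (1 + 1/p) (1 + d/u)`
(`exists_linearProfile_lower_bound`). The Besov-Morrey norm is therefore infinite if `s > m`, or if
`s = m` and `q < ∞`.

In case (iii), where `d = 1` and `m = 1 + 1/u`, this bound does not suffice for `q = ∞`. The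
lacunary series `f t = ∑ 2^(-j) h(2^j t)` with `h t = t g(t)` gains a logarithm. Its piece at
frequency `2^N` sees only the tail, a dilated copy of `f`, and has norm `O(2^(-N (1 + 1/u)))`. But
`κ ∘ f = ∑ κ(t) g(2^j t)`, and about `k` of the terms contribute almost equally to the pairing at
scale `2^(-k)`, which is thus of size `k 2^(-k)`. The supremum over `k` is infinite. -/

namespace BesovMorrey

open Filter Topology FourierTransform

/-! ### Density of compactly supported functions in the Schwartz space -/

section Cutoff

variable {E : Type*} [NormedAddCommGroup E] [InnerProductSpace ℝ E] [FiniteDimensional ℝ E]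

/-- A smooth cutoff which equals `1` on the ball of radius `n + 1`. -/
noncomputable def cutoff (n : ℕ) (x : E) : ℝ :=
  (⟨1, 2, one_pos, one_lt_two⟩ : ContDiffBump (0 : E)) (((n : ℝ) + 1)⁻¹ • x)

theorem cutoff_contDiff (n : ℕ) : ContDiff ℝ (⊤ : ℕ∞) (cutoff n : E → ℝ) :=
  (ContDiffBump.contDiff _).comp (contDiff_const_smul _)

theorem cutoff_hasCompactSupport (n : ℕ) : HasCompactSupport (cutoff n : E → ℝ) := by
  have h := ((⟨1, 2, one_pos, one_lt_two⟩ : ContDiffBump (0 : E)).hasCompactSupport)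
  exact h.comp_homeomorph (Homeomorph.smulOfNeZero (((n : ℝ) + 1)⁻¹) (by positivity))

theorem cutoff_eq_one {n : ℕ} {x : E} (hx : ‖x‖ ≤ n + 1) : cutoff n x = 1 := by
  refine ContDiffBump.one_of_mem_closedBall _ ?_
  rw [mem_closedBall_zero_iff, norm_smul, norm_inv, Real.norm_of_nonneg (by positivity),
    inv_mul_le_iff₀ (by positivity)]
  simpa using hx

theorem cutoff_hasTemperateGrowth (n : ℕ) :
    (cutoff n : E → ℝ).HasTemperateGrowth :=
  (cutoff_hasCompactSupport n).hasTemperateGrowth (cutoff_contDiff n)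

theorem norm_cutoff_le (n : ℕ) (x : E) : ‖cutoff n x‖ ≤ 1 := by
  unfold cutoff
  rw [Real.norm_of_nonneg (ContDiffBump.nonneg _)]
  exact ContDiffBump.le_one _

/-- All cutoffs are one bump composed with dilations by `1/(n+1) ≤ 1`, and composing with a
contraction does not increase derivatives. Hence the bound is uniform in `n`. -/
theorem exists_norm_iteratedFDeriv_one_sub_cutoff_le (i : ℕ) :
    ∃ C : ℝ, ∀ (n : ℕ) (x : E), ‖iteratedFDeriv ℝ i (fun y : E => 1 - cutoff n y) x‖ ≤ C := by
  let χ : ContDiffBump (0 : E) := ⟨1, 2, one_pos, one_lt_two⟩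
  have hχ : ContDiff ℝ (⊤ : ℕ∞) (fun x : E => 1 - χ x) := contDiff_const.sub χ.contDiff
  obtain ⟨C, hC⟩ : ∃ C, ∀ x, ‖iteratedFDeriv ℝ i (fun x : E => 1 - χ x) x‖ ≤ C := by
    have hS := χ.hasCompactSupport.hasTemperateGrowth χ.contDiff
    obtain ⟨C, -, hC⟩ := (χ.hasCompactSupport.toSchwartzMap χ.contDiff).decay 0 i
    refine ⟨‖iteratedFDeriv ℝ i (fun _ : E => (1 : ℝ)) 0‖ + C, fun x => ?_⟩
    have h1 : iteratedFDeriv ℝ i (fun x : E => 1 - χ x) x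
        = iteratedFDeriv ℝ i (fun _ : E => (1 : ℝ)) x - iteratedFDeriv ℝ i χ x := by
      refine iteratedFDeriv_sub_apply (f := fun _ : E => (1 : ℝ)) contDiffAt_const
        ((χ.contDiff (n := i)).contDiffAt)
    rw [h1]
    refine (norm_sub_le _ _).trans (add_le_add (le_of_eq ?_) ?_)
    rotate_left
    · have h := hC x
      rw [pow_zero, one_mul] at h
      exact h
    · rcases Nat.eq_zero_or_pos i with rfl | hi
      · simp
      · rw [iteratedFDeriv_const_of_ne hi.ne']; simp
  refine ⟨C, fun n x => ?_⟩
  have hc : ‖(((n : ℝ) + 1)⁻¹ • ContinuousLinearMap.id ℝ E)‖ ≤ 1 := by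
    refine ContinuousLinearMap.opNorm_le_bound _ zero_le_one fun y => ?_
    rw [smul_apply, norm_smul, norm_inv, Real.norm_of_nonneg (by positivity)]
    refine mul_le_mul_of_nonneg_right ?_ (norm_nonneg _)
    exact inv_le_one_of_one_le₀ (by linarith [n.cast_nonneg (α := ℝ)])
  have h2 := (((n : ℝ) + 1)⁻¹ • ContinuousLinearMap.id ℝ E).iteratedFDeriv_comp_right
    (i := i) hχ x (by exact_mod_cast le_top)
  have h3 : (fun y : E => 1 - cutoff n y)
      = (fun x : E => 1 - χ x) ∘ (((n : ℝ) + 1)⁻¹ • ContinuousLinearMap.id ℝ E) := rfl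
  rw [h3, h2]
  refine (ContinuousMultilinearMap.norm_compContinuousLinearMap_le _ _).trans ?_
  refine (mul_le_of_le_one_right (norm_nonneg _) ?_).trans (hC _)
  exact Finset.prod_le_one (fun _ _ => norm_nonneg _) fun _ _ => hc

/-- The difference vanishes for `‖x‖ < n + 1`. Outside that ball one spare power of `‖x‖` in the
decay of `φ` buys a factor `1/(n+1)` in each seminorm. -/
theorem tendsto_smulLeftCLM_cutoff (φ : 𝓢(E, ℂ)) :
    Tendsto (fun n => SchwartzMap.smulLeftCLM ℂ (cutoff n : E → ℝ) φ) atTop (𝓝 φ) := by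
  rw [(schwartz_withSeminorms ℝ E ℂ).tendsto_nhds]
  rintro ⟨k, m⟩ ε hε
  choose C hC using exists_norm_iteratedFDeriv_one_sub_cutoff_le (E := E)
  choose D hD0 hD using fun i => φ.decay (k + 1) i
  set M : ℝ := ∑ i ∈ Finset.range (m + 1), (m.choose i : ℝ) * C i * D (m - i) with hM
  have hC0 : ∀ i, 0 ≤ C i := fun i => (norm_nonneg _).trans (hC i 0 0)
  have hM0 : 0 ≤ M := Finset.sum_nonneg fun i _ =>
    mul_nonneg (mul_nonneg (by positivity) (hC0 i)) (hD0 _).le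
  have hlim : Tendsto (fun n : ℕ => M * ((n : ℝ) + 1)⁻¹) atTop (𝓝 0) := by
    simpa using (tendsto_one_div_add_atTop_nhds_zero_nat (𝕜 := ℝ)).const_mul M
  filter_upwards [hlim.eventually (gt_mem_nhds hε)] with n hn
  refine lt_of_le_of_lt ?_ hn
  rw [← map_neg_eq_map, neg_sub]
  refine SchwartzMap.seminorm_le_bound ℝ k m _ (by positivity) fun x => ?_
  have hfun : ((φ - SchwartzMap.smulLeftCLM ℂ (cutoff n : E → ℝ) φ : 𝓢(E, ℂ)) : E → ℂ)
      = fun y => (1 - cutoff n y) • φ y := by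
    ext y
    simp [SchwartzMap.smulLeftCLM_apply_apply (cutoff_hasTemperateGrowth n), sub_mul]
  rw [hfun]
  rcases lt_or_ge ‖x‖ ((n : ℝ) + 1) with hx | hx
  · have : (fun y => (1 - cutoff n y) • φ y) =ᶠ[𝓝 x] fun _ => 0 := by
      filter_upwards [(isOpen_lt continuous_norm continuous_const).mem_nhds hx] with y hy
      rw [cutoff_eq_one (le_of_lt hy), sub_self, zero_smul]
    rw [(this.iteratedFDeriv ℝ m).eq_of_nhds]
    have h0 : iteratedFDeriv ℝ m (fun _ : E => (0 : ℂ)) x = 0 := by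
      simp
    rw [h0, norm_zero, mul_zero]
    positivity
  · have hxpos : (0 : ℝ) < n + 1 := by positivity
    have h1 : ‖x‖ ^ k ≤ ‖x‖ ^ (k + 1) * ((n : ℝ) + 1)⁻¹ := by
      rw [pow_succ, mul_assoc]
      refine le_mul_of_one_le_right (by positivity) ?_
      rwa [← div_eq_mul_inv, one_le_div hxpos]
    have h2 := norm_iteratedFDeriv_smul_le (𝕜 := ℝ) (N := (⊤ : ℕ∞))
      (f := fun y : E => 1 - cutoff n y) (g := φ)
      (contDiff_const.sub (cutoff_contDiff n)) (φ.smooth ⊤) x (n := m) (by exact_mod_cast le_top)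
    calc ‖x‖ ^ k * ‖iteratedFDeriv ℝ m (fun y => (1 - cutoff n y) • φ y) x‖
        ≤ (‖x‖ ^ (k + 1) * ((n : ℝ) + 1)⁻¹) * ∑ i ∈ Finset.range (m + 1), (m.choose i : ℝ) *
          ‖iteratedFDeriv ℝ i (fun y : E => 1 - cutoff n y) x‖ *
          ‖iteratedFDeriv ℝ (m - i) φ x‖ := by gcongr
      _ = (∑ i ∈ Finset.range (m + 1), (m.choose i : ℝ) *
          ‖iteratedFDeriv ℝ i (fun y : E => 1 - cutoff n y) x‖ *
          (‖x‖ ^ (k + 1) * ‖iteratedFDeriv ℝ (m - i) φ x‖)) * ((n : ℝ) + 1)⁻¹ := by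
        rw [Finset.mul_sum, Finset.sum_mul]
        refine Finset.sum_congr rfl fun i _ => by ring
      _ ≤ M * ((n : ℝ) + 1)⁻¹ := by
        refine mul_le_mul_of_nonneg_right (Finset.sum_le_sum fun i _ => ?_) (by positivity)
        exact mul_le_mul (mul_le_mul_of_nonneg_left (hC _ _ _) (by positivity)) (hD _ _)
          (by positivity) (mul_nonneg (by positivity) (hC0 i))

end Cutoff

/-- A tempered distribution that is represented by `g` acts on every Schwartz function whose product
with `g` is integrable by integration against `g`. -/
theorem Represents.apply_eq_integral {d : ℕ} {T : 𝓢'(EuclideanSpace ℝ (Fin d), ℂ)}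
    {g : EuclideanSpace ℝ (Fin d) → ℂ} (h : Represents T g)
    (φ : 𝓢(EuclideanSpace ℝ (Fin d), ℂ)) (hφ : Integrable fun x => φ x * g x) :
    T φ = ∫ x, φ x * g x := by
  -- Both sides are limits along the cutoffs: the left by continuity of `T`, the right by dominated
  -- convergence.
  have hT := (T.continuous.tendsto φ).comp (tendsto_smulLeftCLM_cutoff φ)
  refine tendsto_nhds_unique hT ?_
  have hval : ∀ n x, SchwartzMap.smulLeftCLM ℂ (cutoff n : EuclideanSpace ℝ (Fin d) → ℝ) φ x
      = cutoff n x • φ x := fun n x =>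
    SchwartzMap.smulLeftCLM_apply_apply (cutoff_hasTemperateGrowth n) φ x
  have heq : ∀ n, T (SchwartzMap.smulLeftCLM ℂ (cutoff n : EuclideanSpace ℝ (Fin d) → ℝ) φ)
      = ∫ x, cutoff n x • (φ x * g x) := by
    intro n
    rw [h.2]
    · simp_rw [hval, smul_mul_assoc]
    · have : (⇑(SchwartzMap.smulLeftCLM ℂ (cutoff n : EuclideanSpace ℝ (Fin d) → ℝ) φ))
          = fun x => cutoff n x • φ x := funext (hval n)
      rw [this]
      exact (cutoff_hasCompactSupport n).smul_right
  simp only [Function.comp_def]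
  refine Tendsto.congr (fun n => (heq n).symm) ?_
  refine tendsto_integral_of_dominated_convergence (fun x => ‖φ x * g x‖) (fun n => ?_) hφ.norm
    (fun n => ae_of_all _ fun x => ?_) (ae_of_all _ fun x => ?_)
  · exact (cutoff_contDiff n).continuous.aestronglyMeasurable.smul hφ.aestronglyMeasurable
  · rw [norm_smul]
    exact mul_le_of_le_one_left (norm_nonneg _) (norm_cutoff_le n x)
  · refine tendsto_const_nhds.congr' ?_
    filter_upwards [eventually_ge_atTop ⌈‖x‖⌉₊] with n hn
    rw [cutoff_eq_one ((Nat.ceil_le.1 hn).trans (by linarith)), one_smul]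

/-! ### Duality between Morrey norms and concentrated functions -/

section Morrey

variable {d : ℕ} {p u : ℝ}

theorem setLIntegral_ball_le_morreyNorm (hp : 1 ≤ p) (g : EuclideanSpace ℝ (Fin d) → ℂ)
    (y : EuclideanSpace ℝ (Fin d)) {r : ℝ} (hr : 0 < r) :
    ∫⁻ x in Metric.ball y r, ‖g x‖ₑ ^ p
      ≤ volume (Metric.ball y r) ^ (1 - p / u) * morreyNorm p u g ^ p := by
  have hp0 : 0 < p := by linarith
  set V := volume (Metric.ball y r) with hV
  have hV0 : V ≠ 0 := (Metric.measure_ball_pos _ _ hr).ne'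
  have hVt : V ≠ ∞ := measure_ball_lt_top.ne
  set I := ∫⁻ x in Metric.ball y r, ‖g x‖ₑ ^ p with hI
  have h1 : V ^ (1 / u - 1 / p) * I ^ (1 / p) ≤ morreyNorm p u g :=
    le_iSup_of_le y (le_iSup_of_le r (le_iSup_of_le hr le_rfl))
  have h2 := ENNReal.rpow_le_rpow h1 hp0.le
  rw [ENNReal.mul_rpow_of_nonneg _ _ hp0.le, ← ENNReal.rpow_mul, ← ENNReal.rpow_mul,
    one_div_mul_cancel hp0.ne', ENNReal.rpow_one] at h2
  calc I = V ^ (1 - p / u) * (V ^ ((1 / u - 1 / p) * p) * I) := by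
        rw [← mul_assoc, ← ENNReal.rpow_add _ _ hV0 hVt]
        have : 1 - p / u + (1 / u - 1 / p) * p = 0 := by
          field_simp
          ring
        rw [this, ENNReal.rpow_zero, one_mul]
    _ ≤ _ := by gcongr

/-- A single term suffices: for the least `n` with `‖x‖ < 2^n r` one has `2^n ≤ 2 (1 + ‖x‖/r)`,
which costs the factor `2^(d+1)`. -/
theorem enorm_le_tsum_indicator_ball {Ψ : EuclideanSpace ℝ (Fin d) → ℂ} {C r : ℝ} (hr : 0 < r)
    (hΨ : ∀ x, (1 + ‖x‖ / r) ^ (d + 1) * ‖Ψ x‖ ≤ C) (x : EuclideanSpace ℝ (Fin d)) :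
    ‖Ψ x‖ₑ ≤ ∑' n : ℕ, ENNReal.ofReal (2 ^ (d + 1) * C) * (2⁻¹ ^ (d + 1)) ^ n *
      (Metric.ball (0 : EuclideanSpace ℝ (Fin d)) (2 ^ n * r)).indicator (fun _ => 1) x := by
  obtain ⟨n, hn, hn'⟩ : ∃ n : ℕ, ‖x‖ < 2 ^ n * r ∧ (2 : ℝ) ^ n ≤ 2 * (1 + ‖x‖ / r) := by
    have hex : ∃ n : ℕ, ‖x‖ < 2 ^ n * r := by
      obtain ⟨n, hn⟩ := pow_unbounded_of_one_lt (‖x‖ / r) one_lt_two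
      exact ⟨n, (div_lt_iff₀ hr).1 hn⟩
    classical
    refine ⟨Nat.find hex, Nat.find_spec hex, ?_⟩
    rcases Nat.eq_zero_or_pos (Nat.find hex) with h | h
    · rw [h, pow_zero]
      have : 0 ≤ ‖x‖ / r := by positivity
      linarith
    · obtain ⟨m, hm⟩ := Nat.exists_eq_succ_of_ne_zero h.ne'
      have h3 := Nat.find_min hex (m := m) (by omega)
      rw [not_lt, ← le_div_iff₀ hr] at h3
      rw [hm, pow_succ]
      linarith
  refine le_trans ?_ (ENNReal.le_tsum n)
  rw [Set.indicator_of_mem (by simpa using hn), mul_one]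
  have hpow : ((2 : ℝ) ^ n) ^ (d + 1) * ‖Ψ x‖ ≤ 2 ^ (d + 1) * C := by
    calc ((2 : ℝ) ^ n) ^ (d + 1) * ‖Ψ x‖ ≤ (2 * (1 + ‖x‖ / r)) ^ (d + 1) * ‖Ψ x‖ := by gcongr
      _ = 2 ^ (d + 1) * ((1 + ‖x‖ / r) ^ (d + 1) * ‖Ψ x‖) := by rw [mul_pow, mul_assoc]
      _ ≤ _ := by gcongr; exact hΨ x
  have h4 : ‖Ψ x‖ₑ = ENNReal.ofReal ‖Ψ x‖ := (ofReal_norm _).symm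
  have h5 : ((2⁻¹ : ℝ≥0∞) ^ (d + 1)) ^ n = ENNReal.ofReal (((2⁻¹ : ℝ) ^ (d + 1)) ^ n) := by
    rw [ENNReal.ofReal_pow (by positivity), ENNReal.ofReal_pow (by positivity),
      ENNReal.ofReal_inv_of_pos two_pos, ENNReal.ofReal_ofNat]
  rw [h4, h5, ← ENNReal.ofReal_mul' (by positivity)]
  refine ENNReal.ofReal_le_ofReal ?_
  have h6 : ((2⁻¹ : ℝ) ^ (d + 1)) ^ n = (((2 : ℝ) ^ n) ^ (d + 1))⁻¹ := by
    rw [inv_pow, inv_pow, ← pow_mul, ← pow_mul, mul_comm]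
  rw [h6, ← div_eq_mul_inv, le_div_iff₀ (by positivity), mul_comm]
  exact hpow

/-- On the ball of radius `2^n r` the Morrey norm allows growth `2^(n d (1 - p/u)) ≤ 2^(n d)`. The
decay `2^(-n (d+1))` of `Ψ` beats it and leaves a geometric series with sum `2`. -/
theorem lintegral_rpow_mul_le_morreyNorm (hp : 1 ≤ p) (hpu : p ≤ u)
    {g Ψ : EuclideanSpace ℝ (Fin d) → ℂ} (hg : AEStronglyMeasurable g) {C r : ℝ} (hr : 0 < r)
    (hΨ : ∀ x, (1 + ‖x‖ / r) ^ (d + 1) * ‖Ψ x‖ ≤ C) :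
    ∫⁻ x, ‖g x‖ₑ ^ p * ‖Ψ x‖ₑ ≤ ENNReal.ofReal (2 ^ (d + 1) * C) * 2 *
      volume (Metric.ball (0 : EuclideanSpace ℝ (Fin d)) r) ^ (1 - p / u) *
        morreyNorm p u g ^ p := by
  have hu : 0 < u := by linarith
  set M := morreyNorm p u g
  set K := ENNReal.ofReal (2 ^ (d + 1) * C)
  set V := volume (Metric.ball (0 : EuclideanSpace ℝ (Fin d)) r)
  have hexp : 0 ≤ 1 - p / u := by
    rw [sub_nonneg, div_le_one hu]; exact hpu
  have hexp1 : 1 - p / u ≤ 1 := by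
    have : 0 ≤ p / u := by positivity
    linarith
  have hgm : AEMeasurable fun x => ‖g x‖ₑ ^ p := hg.enorm.pow_const p
  calc ∫⁻ x, ‖g x‖ₑ ^ p * ‖Ψ x‖ₑ
      ≤ ∫⁻ x, ∑' n : ℕ, ‖g x‖ₑ ^ p * (K * (2⁻¹ ^ (d + 1)) ^ n *
        (Metric.ball (0 : EuclideanSpace ℝ (Fin d)) (2 ^ n * r)).indicator (fun _ => 1) x) := by
        refine lintegral_mono fun x => ?_
        rw [ENNReal.tsum_mul_left]
        gcongr
        exact enorm_le_tsum_indicator_ball hr hΨ x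
    _ = ∑' n : ℕ, ∫⁻ x, ‖g x‖ₑ ^ p * (K * (2⁻¹ ^ (d + 1)) ^ n *
        (Metric.ball (0 : EuclideanSpace ℝ (Fin d)) (2 ^ n * r)).indicator (fun _ => 1) x) := by
        refine lintegral_tsum fun n => hgm.mul (Measurable.aemeasurable ?_)
        exact (measurable_const.indicator measurableSet_ball).const_mul _
    _ ≤ ∑' n : ℕ, K * V ^ (1 - p / u) * M ^ p * 2⁻¹ ^ n := by
        refine ENNReal.tsum_le_tsum fun n => ?_
        have h1 : ∀ x, ‖g x‖ₑ ^ p * (K * (2⁻¹ ^ (d + 1)) ^ n *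
            (Metric.ball (0 : EuclideanSpace ℝ (Fin d)) (2 ^ n * r)).indicator (fun _ => 1) x)
            = (K * (2⁻¹ ^ (d + 1)) ^ n) *
            (Metric.ball (0 : EuclideanSpace ℝ (Fin d)) (2 ^ n * r)).indicator
              (fun x => ‖g x‖ₑ ^ p) x := by
          intro x
          by_cases hx : x ∈ Metric.ball (0 : EuclideanSpace ℝ (Fin d)) (2 ^ n * r)
          · rw [Set.indicator_of_mem hx, Set.indicator_of_mem hx, mul_one, mul_comm]
          · simp [Set.indicator_of_notMem hx]
        simp_rw [h1]
        have hK : K * (2⁻¹ ^ (d + 1)) ^ n ≠ ∞ := by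
          refine ENNReal.mul_ne_top ENNReal.ofReal_ne_top ?_
          refine ENNReal.pow_ne_top (ENNReal.pow_ne_top ?_)
          simp
        rw [lintegral_const_mul' _ _ hK, lintegral_indicator measurableSet_ball]
        have hvol : volume (Metric.ball (0 : EuclideanSpace ℝ (Fin d)) (2 ^ n * r))
            = (2 ^ d) ^ n * V := by
          rw [Measure.addHaar_ball_mul_of_pos _ _ (by positivity), finrank_euclideanSpace_fin]
          congr 1
          rw [ENNReal.ofReal_pow (by positivity), ENNReal.ofReal_pow (by positivity),
            ENNReal.ofReal_ofNat, ← pow_mul, ← pow_mul, mul_comm]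
        have h2 := setLIntegral_ball_le_morreyNorm (u := u) hp g 0 (r := 2 ^ n * r) (by positivity)
        rw [hvol, ENNReal.mul_rpow_of_nonneg _ _ hexp] at h2
        have h3 : (((2 : ℝ≥0∞) ^ d) ^ n) ^ (1 - p / u) ≤ (2 ^ d) ^ n := by
          conv_rhs => rw [← ENNReal.rpow_one ((2 ^ d) ^ n)]
          exact ENNReal.rpow_le_rpow_of_exponent_le
            (one_le_pow₀ (one_le_pow₀ one_le_two)) hexp1
        have h4 : ((2⁻¹ : ℝ≥0∞) ^ (d + 1)) ^ n * (2 ^ d) ^ n = 2⁻¹ ^ n := by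
          rw [← mul_pow]
          congr 1
          rw [pow_succ, mul_right_comm, ← mul_pow, ENNReal.inv_mul_cancel two_ne_zero (by simp),
            one_pow, one_mul]
        calc K * (2⁻¹ ^ (d + 1)) ^ n *
              ∫⁻ x in Metric.ball 0 (2 ^ n * r), ‖g x‖ₑ ^ p
            ≤ K * (2⁻¹ ^ (d + 1)) ^ n * ((2 ^ d) ^ n * V ^ (1 - p / u) * M ^ p) := by
              refine mul_le_mul_right (h2.trans ?_) _
              gcongr
          _ = K * V ^ (1 - p / u) * M ^ p * ((2⁻¹ ^ (d + 1)) ^ n * (2 ^ d) ^ n) := by ring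
          _ = _ := by rw [h4]
    _ = _ := by
        rw [ENNReal.tsum_mul_left, ENNReal.tsum_geometric, ENNReal.one_sub_inv_two, inv_inv]
        ring

/-- Hölder for `|Ψ g| = |Ψ|^(1 - 1/p) (|g|^p |Ψ|)^(1/p)`. Keeping the `L₁` norm of `Ψ` as a separate
factor matters: `Ψ` may live on a box much thinner than the ball of radius `r`. -/
theorem lintegral_mul_le_morreyNorm (hp : 1 ≤ p) (hpu : p ≤ u)
    {g Ψ : EuclideanSpace ℝ (Fin d) → ℂ} (hg : AEStronglyMeasurable g)
    (hΨm : AEStronglyMeasurable Ψ) {C r : ℝ} (hr : 0 < r)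
    (hΨ : ∀ x, (1 + ‖x‖ / r) ^ (d + 1) * ‖Ψ x‖ ≤ C) :
    ∫⁻ x, ‖Ψ x * g x‖ₑ ≤ (∫⁻ x, ‖Ψ x‖ₑ) ^ (1 - 1 / p) *
      (ENNReal.ofReal (2 ^ (d + 1) * C) * 2 *
        volume (Metric.ball (0 : EuclideanSpace ℝ (Fin d)) r) ^ (1 - p / u)) ^ (1 / p) *
        morreyNorm p u g := by
  have hp0 : 0 < p := by linarith
  have hp1 : 0 ≤ 1 - 1 / p := by
    rw [sub_nonneg, div_le_one hp0]; exact hp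
  have h1 : ∀ x, ‖Ψ x * g x‖ₑ
      = (‖Ψ x‖ₑ) ^ (1 - 1 / p) * (‖g x‖ₑ ^ p * ‖Ψ x‖ₑ) ^ (1 / p) := by
    intro x
    rw [ENNReal.mul_rpow_of_nonneg _ _ (by positivity), ← ENNReal.rpow_mul,
      mul_one_div_cancel hp0.ne', ENNReal.rpow_one, mul_left_comm,
      ← ENNReal.rpow_add_of_nonneg _ _ hp1 (by positivity), sub_add_cancel, ENNReal.rpow_one,
      enorm_mul, mul_comm]
  simp_rw [h1]
  refine (ENNReal.lintegral_mul_norm_pow_le hΨm.enorm ((hg.enorm.pow_const p).mul hΨm.enorm)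
    hp1 (by positivity) (by ring)).trans ?_
  rw [mul_assoc]
  gcongr
  refine (ENNReal.rpow_le_rpow (lintegral_rpow_mul_le_morreyNorm hp hpu hg hr hΨ)
    (by positivity)).trans (le_of_eq ?_)
  rw [ENNReal.mul_rpow_of_nonneg _ _ (by positivity) (z := 1 / p), ← ENNReal.rpow_mul,
    mul_one_div_cancel hp0.ne', ENNReal.rpow_one]

/-- Testing a distribution against a Schwartz function that is concentrated on a ball of radius `r`
bounds its Morrey norm from below. -/
theorem enorm_apply_div_le_distMorreyNorm (hp : 1 ≤ p) (hpu : p ≤ u)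
    (T : 𝓢'(EuclideanSpace ℝ (Fin d), ℂ)) (Ψ : 𝓢(EuclideanSpace ℝ (Fin d), ℂ)) {C r : ℝ}
    (hr : 0 < r) (hΨ : ∀ x, (1 + ‖x‖ / r) ^ (d + 1) * ‖Ψ x‖ ≤ C) :
    ‖T Ψ‖ₑ / ((∫⁻ x, ‖Ψ x‖ₑ) ^ (1 - 1 / p) *
      (ENNReal.ofReal (2 ^ (d + 1) * C) * 2 *
        volume (Metric.ball (0 : EuclideanSpace ℝ (Fin d)) r) ^ (1 - p / u)) ^ (1 / p)) ≤
      distMorreyNorm p u T := by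
  have hu : 0 < u := by linarith
  have hp0 : 0 < p := by linarith
  refine le_iInf fun g => le_iInf fun hg => ?_
  rcases eq_or_ne (morreyNorm p u g) ∞ with hM | hM
  · rw [hM]; exact le_top
  refine ENNReal.div_le_of_le_mul ?_
  have hgm := hg.1.aestronglyMeasurable
  have hΨm : AEStronglyMeasurable (Ψ : EuclideanSpace ℝ (Fin d) → ℂ) :=
    Ψ.continuous.aestronglyMeasurable
  have hle := lintegral_mul_le_morreyNorm hp hpu hgm hΨm hr hΨ
  have hexp : 0 ≤ 1 - p / u := by
    rw [sub_nonneg, div_le_one hu]; exact hpu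
  have hp1 : 0 ≤ 1 - 1 / p := by
    rw [sub_nonneg, div_le_one hp0]; exact hp
  -- A finite Morrey norm makes `Ψ g` integrable, so the representation extends from compactly
  -- supported test functions to `Ψ`.
  have hfin : ∫⁻ x, ‖Ψ x * g x‖ₑ < ∞ := by
    refine hle.trans_lt (ENNReal.mul_lt_top (ENNReal.mul_lt_top ?_ ?_) hM.lt_top)
    · exact ENNReal.rpow_lt_top_of_nonneg hp1 (Ψ.integrable (μ := volume)).2.ne
    · refine ENNReal.rpow_lt_top_of_nonneg (by positivity) (ENNReal.mul_ne_top ?_ ?_)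
      · exact ENNReal.mul_ne_top ENNReal.ofReal_ne_top (by simp)
      · exact ENNReal.rpow_ne_top_of_nonneg hexp measure_ball_lt_top.ne
  rw [hg.apply_eq_integral Ψ ⟨hΨm.mul hgm, hfin⟩, mul_comm]
  exact (enorm_integral_le_lintegral_enorm _).trans hle

end Morrey

/-! ### Dyadic multipliers on tempered distributions -/

section Multiplier

variable {d : ℕ}

theorem integral_fourier_mul_eq_integral_mul_fourier
    (η : 𝓢(EuclideanSpace ℝ (Fin d), ℂ)) {F : EuclideanSpace ℝ (Fin d) → ℂ} (hF : Integrable F) :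
    ∫ x, (𝓕 η) x * F x = ∫ ξ, η ξ * 𝓕 F ξ := by
  have := VectorFourier.integral_fourierIntegral_smul_eq_flip (μ := volume) (ν := volume)
    (L := innerₗ (EuclideanSpace ℝ (Fin d))) (e := Real.fourierChar) (f := η) (g := F)
    Real.continuous_fourierChar continuous_inner η.integrable hF
  rw [flip_innerₗ] at this
  exact this

/-- Every integrable function is a tempered distribution. -/
theorem exists_eq_integral {F : EuclideanSpace ℝ (Fin d) → ℂ} (hF : Integrable F) :
    ∃ T : 𝓢'(EuclideanSpace ℝ (Fin d), ℂ), ∀ φ : 𝓢(EuclideanSpace ℝ (Fin d), ℂ),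
      T φ = ∫ x, φ x * F x := by
  have hm : MemLp F 1 volume := memLp_one_iff_integrable.2 hF
  have : Fact ((1 : ℝ≥0∞) ≤ 1) := ⟨le_rfl⟩
  refine ⟨Lp.toTemperedDistribution (hm.toLp F), fun φ => ?_⟩
  rw [Lp.toTemperedDistribution_apply]
  refine integral_congr_ae ?_
  filter_upwards [hm.coeFn_toLp] with x hx
  rw [hx, smul_eq_mul]

theorem represents_of_eq_integral {T : 𝓢'(EuclideanSpace ℝ (Fin d), ℂ)}
    {F : EuclideanSpace ℝ (Fin d) → ℂ} (hF : Integrable F)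
    (hT : ∀ φ : 𝓢(EuclideanSpace ℝ (Fin d), ℂ), T φ = ∫ x, φ x * F x) : Represents T F :=
  ⟨hF.locallyIntegrable, fun φ _ => hT φ⟩

namespace IsDyadicGenerator

variable {φ₀ : EuclideanSpace ℝ (Fin d) → ℝ}

theorem contDiff_dyadicPiece (h : IsDyadicGenerator φ₀) (k : ℕ) :
    ContDiff ℝ (⊤ : ℕ∞) (dyadicPiece φ₀ k) := by
  cases k with
  | zero => exact h.contDiff
  | succ k =>
    exact (h.contDiff.comp (contDiff_const_smul _)).sub (h.contDiff.comp (contDiff_const_smul _))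

theorem dyadicPiece_eq_zero_of_le (h : IsDyadicGenerator φ₀) (k : ℕ)
    {ξ : EuclideanSpace ℝ (Fin d)} (hξ : ‖ξ‖ ≤ 2 ^ k) : dyadicPiece φ₀ (k + 1) ξ = 0 := by
  have h1 : ‖((2 : ℝ) ^ k)⁻¹ • ξ‖ ≤ 1 := by
    rw [norm_smul, norm_inv, Real.norm_of_nonneg (by positivity), inv_mul_le_iff₀ (by positivity)]
    simpa using hξ
  have h2 : ‖((2 : ℝ) ^ (k + 1))⁻¹ • ξ‖ ≤ 1 := by
    rw [norm_smul, norm_inv, Real.norm_of_nonneg (by positivity), inv_mul_le_iff₀ (by positivity),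
      pow_succ]
    have := norm_nonneg ξ
    linarith
  simp only [dyadicPiece, h.eq_one _ h1, h.eq_one _ h2, sub_self]

theorem dyadicPiece_eq_zero_of_ge (h : IsDyadicGenerator φ₀) (k : ℕ)
    {ξ : EuclideanSpace ℝ (Fin d)} (hξ : 3 / 2 * 2 ^ k ≤ ‖ξ‖) : dyadicPiece φ₀ k ξ = 0 := by
  have key : ∀ j ≤ k, φ₀ (((2 : ℝ) ^ j)⁻¹ • ξ) = 0 := by
    intro j hj
    refine h.eq_zero _ ?_
    rw [norm_smul, norm_inv, Real.norm_of_nonneg (by positivity), le_inv_mul_iff₀ (by positivity)]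
    have : (2 : ℝ) ^ j ≤ 2 ^ k := pow_le_pow_right₀ one_le_two hj
    linarith
  cases k with
  | zero => simpa [dyadicPiece] using key 0 le_rfl
  | succ k => simp only [dyadicPiece, key (k + 1) le_rfl, key k (Nat.le_succ k), sub_self]

/-- The annulus is a genuine one because `3/2 < 2`. Test functions with frequencies in it do not see
the choice of `φ₀`, which makes the lower bounds uniform in the decomposition. -/
theorem dyadicPiece_eq_one (h : IsDyadicGenerator φ₀) (k : ℕ)
    {ξ : EuclideanSpace ℝ (Fin d)} (hξ : 3 / 2 * 2 ^ k ≤ ‖ξ‖) (hξ' : ‖ξ‖ ≤ 2 ^ (k + 1)) :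
    dyadicPiece φ₀ (k + 1) ξ = 1 := by
  have h1 : 3 / 2 ≤ ‖((2 : ℝ) ^ k)⁻¹ • ξ‖ := by
    rw [norm_smul, norm_inv, Real.norm_of_nonneg (by positivity), le_inv_mul_iff₀ (by positivity)]
    linarith
  have h2 : ‖((2 : ℝ) ^ (k + 1))⁻¹ • ξ‖ ≤ 1 := by
    rw [norm_smul, norm_inv, Real.norm_of_nonneg (by positivity), inv_mul_le_iff₀ (by positivity)]
    simpa using hξ'
  simp only [dyadicPiece, h.eq_zero _ h1, h.eq_one _ h2, sub_zero]

theorem hasCompactSupport_dyadicPiece (h : IsDyadicGenerator φ₀) (k : ℕ) :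
    HasCompactSupport (dyadicPiece φ₀ k) := by
  refine HasCompactSupport.intro (isCompact_closedBall 0 (3 / 2 * 2 ^ k)) fun x hx =>
    h.dyadicPiece_eq_zero_of_ge k ?_
  rw [mem_closedBall_zero_iff, not_le] at hx
  exact hx.le

theorem hasCompactSupport_ofReal_dyadicPiece (h : IsDyadicGenerator φ₀) (k : ℕ) :
    HasCompactSupport fun ξ => (dyadicPiece φ₀ k ξ : ℂ) :=
  (h.hasCompactSupport_dyadicPiece k).comp_left Complex.ofReal_zero

theorem contDiff_ofReal_dyadicPiece (h : IsDyadicGenerator φ₀) (k : ℕ) :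
    ContDiff ℝ (⊤ : ℕ∞) fun ξ => (dyadicPiece φ₀ k ξ : ℂ) :=
  Complex.ofRealCLM.contDiff.comp (h.contDiff_dyadicPiece k)

theorem hasTemperateGrowth_dyadicPiece (h : IsDyadicGenerator φ₀) (k : ℕ) :
    (fun ξ => (dyadicPiece φ₀ k ξ : ℂ)).HasTemperateGrowth :=
  (h.hasCompactSupport_ofReal_dyadicPiece k).hasTemperateGrowth (h.contDiff_ofReal_dyadicPiece k)

/-- The dyadic pieces as Schwartz functions. -/
noncomputable def schwartzPiece (h : IsDyadicGenerator φ₀) (k : ℕ) :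
    𝓢(EuclideanSpace ℝ (Fin d), ℂ) :=
  (h.hasCompactSupport_ofReal_dyadicPiece k).toSchwartzMap (h.contDiff_ofReal_dyadicPiece k)

theorem schwartzPiece_apply (h : IsDyadicGenerator φ₀) (k : ℕ) (ξ : EuclideanSpace ℝ (Fin d)) :
    h.schwartzPiece k ξ = (dyadicPiece φ₀ k ξ : ℂ) := rfl

/-- Littlewood-Paley pieces agree with the distribution on test functions whose Fourier transform
lives where the multiplier equals `1`. -/
theorem littlewoodPaleyPiece_apply_fourier (h : IsDyadicGenerator φ₀) (k : ℕ)
    (T : 𝓢'(EuclideanSpace ℝ (Fin d), ℂ)) (B : 𝓢(EuclideanSpace ℝ (Fin d), ℂ))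
    (hB : ∀ ξ, B ξ ≠ 0 → dyadicPiece φ₀ k ξ = 1) :
    littlewoodPaleyPiece φ₀ T k (𝓕 B) = T (𝓕 B) := by
  rw [littlewoodPaleyPiece, TemperedDistribution.fourierMultiplierCLM_apply_apply,
    FourierTransform.fourierInv_fourier_eq]
  congr 2
  ext ξ
  rw [SchwartzMap.smulLeftCLM_apply_apply (h.hasTemperateGrowth_dyadicPiece k)]
  by_cases hξ : B ξ = 0
  · simp [hξ]
  · simp [hB ξ hξ]

theorem littlewoodPaleyPiece_eq_zero (h : IsDyadicGenerator φ₀) (k : ℕ)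
    {T : 𝓢'(EuclideanSpace ℝ (Fin d), ℂ)} {F : EuclideanSpace ℝ (Fin d) → ℂ}
    (hF : Integrable F) (hT : ∀ φ : 𝓢(EuclideanSpace ℝ (Fin d), ℂ), T φ = ∫ x, φ x * F x)
    (hz : ∀ ξ, dyadicPiece φ₀ k ξ ≠ 0 → 𝓕 F ξ = 0) :
    littlewoodPaleyPiece φ₀ T k = 0 := by
  ext φ
  rw [littlewoodPaleyPiece, TemperedDistribution.fourierMultiplierCLM_apply_apply, hT,
    integral_fourier_mul_eq_integral_mul_fourier _ hF]
  refine (integral_eq_zero_of_ae (ae_of_all _ fun ξ => ?_)).trans rfl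
  rw [SchwartzMap.smulLeftCLM_apply_apply (h.hasTemperateGrowth_dyadicPiece k)]
  by_cases hξ : dyadicPiece φ₀ k ξ = 0
  · simp [hξ]
  · simp [hz ξ hξ]

/-- Since `𝓕⁻` is `𝓕` followed by a reflection, it also turns the convolution of `𝓕 φ_k` with `φ`
into the product of `φ_k` and `𝓕⁻ φ`. -/
theorem fourier_smulLeft_fourierInv (h : IsDyadicGenerator φ₀) (k : ℕ)
    (φ : 𝓢(EuclideanSpace ℝ (Fin d), ℂ)) (x : EuclideanSpace ℝ (Fin d)) :
    (𝓕 (SchwartzMap.smulLeftCLM ℂ (fun ξ => (dyadicPiece φ₀ k ξ : ℂ)) (𝓕⁻ φ)) :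
      𝓢(EuclideanSpace ℝ (Fin d), ℂ)) x = ∫ y, (𝓕 (h.schwartzPiece k)) (x - y) * φ y := by
  set K : 𝓢(EuclideanSpace ℝ (Fin d), ℂ) := 𝓕 (h.schwartzPiece k)
  set S := SchwartzMap.convolution (ContinuousLinearMap.mul ℂ ℂ) K φ with hS
  have hinv : ∀ (f : 𝓢(EuclideanSpace ℝ (Fin d), ℂ)) (ξ : EuclideanSpace ℝ (Fin d)),
      (𝓕⁻ f) ξ = (𝓕 f) (-ξ) := by
    intro f ξ
    rw [SchwartzMap.fourierInv_coe, SchwartzMap.fourier_coe, Real.fourierInv_eq_fourier_neg]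
  have h1 : SchwartzMap.smulLeftCLM ℂ (fun ξ => (dyadicPiece φ₀ k ξ : ℂ)) (𝓕⁻ φ) = 𝓕⁻ S := by
    ext ξ
    rw [SchwartzMap.smulLeftCLM_apply_apply (h.hasTemperateGrowth_dyadicPiece k), hinv S, hS,
      SchwartzMap.fourier_convolution, SchwartzMap.pairing_apply_apply, ← hinv, ← hinv,
      FourierTransform.fourierInv_fourier_eq]
    rfl
  rw [h1, FourierTransform.fourier_fourierInv_eq, hS, SchwartzMap.convolution_apply,
    convolution_eq_swap]
  rfl

end IsDyadicGenerator

end Multiplier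

/-! ### Littlewood-Paley pieces of integrable functions as convolutions -/

section Convolution

variable {d : ℕ} {F : EuclideanSpace ℝ (Fin d) → ℂ} (K : 𝓢(EuclideanSpace ℝ (Fin d), ℂ))

theorem integrable_kernel_mul (hF : Integrable F) :
    Integrable (fun z : EuclideanSpace ℝ (Fin d) × EuclideanSpace ℝ (Fin d) => K (z.1 - z.2) * F z.1)
      (volume.prod volume) := by
  have h1 : Integrable (fun z : EuclideanSpace ℝ (Fin d) × EuclideanSpace ℝ (Fin d) =>
      F z.1 * K z.2) (volume.prod volume) := hF.mul_prod K.integrable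
  have h2 : MeasurePreserving (fun z : EuclideanSpace ℝ (Fin d) × EuclideanSpace ℝ (Fin d) =>
      (z.1, z.1 - z.2)) (volume.prod volume) (volume.prod volume) :=
    (MeasurePreserving.id volume).skew_product (g := fun x y => x - y)
      (by fun_prop) (ae_of_all _ fun x => (Measure.measurePreserving_sub_left volume x).map_eq)
  have h3 := h2.integrable_comp_of_integrable h1
  refine h3.congr (ae_of_all _ fun z => ?_)
  simp [mul_comm]

theorem integral_kernel_bounds (hF : Integrable F) {A B : ℝ} (hA : ∀ z, ‖K z‖ ≤ A)
    (hB : ∫ z, ‖K z‖ ≤ B) :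
    Integrable (fun y => ∫ x, K (x - y) * F x) ∧
    (∀ y, ‖∫ x, K (x - y) * F x‖ ≤ A * ∫ x, ‖F x‖) ∧
    ∫ y, ‖∫ x, K (x - y) * F x‖ ≤ B * ∫ x, ‖F x‖ := by
  have hI := integrable_kernel_mul K hF
  refine ⟨hI.integral_prod_right, fun y => ?_, ?_⟩
  · refine (norm_integral_le_integral_norm _).trans ?_
    rw [← integral_const_mul]
    refine integral_mono_of_nonneg (ae_of_all _ fun x => norm_nonneg _) (hF.norm.const_mul A)
      (ae_of_all _ fun x => ?_)
    simp only [norm_mul]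
    exact mul_le_mul_of_nonneg_right (hA _) (norm_nonneg _)
  · have hN := hI.norm
    calc ∫ y, ‖∫ x, K (x - y) * F x‖ ≤ ∫ y, ∫ x, ‖K (x - y) * F x‖ :=
          integral_mono_of_nonneg (ae_of_all _ fun _ => norm_nonneg _) hN.integral_prod_right
            (ae_of_all _ fun y => norm_integral_le_integral_norm _)
      _ = ∫ x, ∫ y, ‖K (x - y) * F x‖ := (integral_integral_swap
            (f := fun x y => ‖K (x - y) * F x‖) hN).symm
      _ = ∫ x, (∫ z, ‖K z‖) * ‖F x‖ := by
          refine integral_congr_ae (ae_of_all _ fun x => ?_)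
          simp only [norm_mul]
          rw [integral_mul_const, integral_sub_left_eq_self (fun z => ‖K z‖) volume x]
      _ ≤ B * ∫ x, ‖F x‖ := by
          rw [integral_const_mul]
          exact mul_le_mul_of_nonneg_right hB (integral_nonneg fun _ => norm_nonneg _)

theorem represents_littlewoodPaleyPiece {φ₀ : EuclideanSpace ℝ (Fin d) → ℝ}
    (h : IsDyadicGenerator φ₀) (k : ℕ) {T : 𝓢'(EuclideanSpace ℝ (Fin d), ℂ)}
    (hF : Integrable F) (hT : ∀ φ : 𝓢(EuclideanSpace ℝ (Fin d), ℂ), T φ = ∫ x, φ x * F x) :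
    Represents (littlewoodPaleyPiece φ₀ T k)
      (fun y => ∫ x, (𝓕 (h.schwartzPiece k)) (x - y) * F x) := by
  set K : 𝓢(EuclideanSpace ℝ (Fin d), ℂ) := 𝓕 (h.schwartzPiece k)
  have hI := integrable_kernel_mul K hF
  refine ⟨hI.integral_prod_right.locallyIntegrable, fun φ _ => ?_⟩
  rw [littlewoodPaleyPiece, TemperedDistribution.fourierMultiplierCLM_apply_apply, hT]
  simp_rw [h.fourier_smulLeft_fourierInv k φ]
  have hφ : Integrable (fun z : EuclideanSpace ℝ (Fin d) × EuclideanSpace ℝ (Fin d) =>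
      φ z.2 * (K (z.1 - z.2) * F z.1)) (volume.prod volume) := by
    refine hI.bdd_mul (c := SchwartzMap.seminorm ℝ 0 0 φ) ?_ (ae_of_all _ fun z => ?_)
    · exact (φ.continuous.comp continuous_snd).aestronglyMeasurable
    · exact SchwartzMap.norm_le_seminorm ℝ φ _
  calc ∫ x, (∫ y, K (x - y) * φ y) * F x = ∫ x, ∫ y, φ y * (K (x - y) * F x) := by
        refine integral_congr_ae (ae_of_all _ fun x => ?_)
        simp only
        rw [← integral_mul_const]
        exact integral_congr_ae (ae_of_all _ fun y => by simp only; ring)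
    _ = ∫ y, ∫ x, φ y * (K (x - y) * F x) :=
        integral_integral_swap (f := fun x y => φ y * (K (x - y) * F x)) hφ
    _ = ∫ y, φ y * ∫ x, K (x - y) * F x :=
        integral_congr_ae (ae_of_all _ fun y => integral_const_mul _ _)

end Convolution

/-! ### Upper bounds for Morrey norms -/

section Upper

variable {d : ℕ} {p u : ℝ}

/-- On each ball Hölder bounds the `L_p` norm by the `L_u` norm, and the powers of the volume cancel
exactly. The `L_u` norm is then interpolated between `L_∞` and `L₁`. -/
theorem morreyNorm_le_of_bounded (hp : 1 ≤ p) (hpu : p ≤ u)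
    {g : EuclideanSpace ℝ (Fin d) → ℂ} (hg : AEStronglyMeasurable g) {A B : ℝ≥0∞}
    (hA : ∀ x, ‖g x‖ₑ ≤ A) (hB : ∫⁻ x, ‖g x‖ₑ ≤ B) :
    morreyNorm p u g ≤ A ^ (1 - 1 / u) * B ^ (1 / u) := by
  have hp0 : 0 < p := by linarith
  have hu : 1 ≤ u := hp.trans hpu
  have hu0 : 0 < u := by linarith
  have hpu1 : 0 ≤ 1 - p / u := by
    rw [sub_nonneg, div_le_one hu0]; exact hpu
  refine iSup_le fun y => iSup_le fun r => iSup_le fun hr => ?_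
  set V := volume (Metric.ball y r) with hV
  have hV0 : V ≠ 0 := (Metric.measure_ball_pos _ _ hr).ne'
  have hVt : V ≠ ∞ := measure_ball_lt_top.ne
  set J := ∫⁻ x in Metric.ball y r, ‖g x‖ₑ ^ u with hJ
  have h1 : ∫⁻ x in Metric.ball y r, ‖g x‖ₑ ^ p ≤ J ^ (p / u) * V ^ (1 - p / u) := by
    have h := ENNReal.lintegral_mul_norm_pow_le (μ := volume.restrict (Metric.ball y r))
      (f := fun x => ‖g x‖ₑ ^ u) (g := fun _ => 1) (hg.restrict.enorm.pow_const u)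
      aemeasurable_const (p := p / u) (q := 1 - p / u) (by positivity) hpu1 (by ring)
    have h2 : ∀ x, (‖g x‖ₑ ^ u) ^ (p / u) * (1 : ℝ≥0∞) ^ (1 - p / u) = ‖g x‖ₑ ^ p := by
      intro x
      rw [ENNReal.one_rpow, mul_one, ← ENNReal.rpow_mul, mul_div_cancel₀ _ hu0.ne']
    simp_rw [h2] at h
    refine h.trans (le_of_eq ?_)
    simp [hV, hJ]
  have h3 : J ≤ A ^ (u - 1) * B := by
    calc J ≤ ∫⁻ x in Metric.ball y r, A ^ (u - 1) * ‖g x‖ₑ := by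
          refine lintegral_mono fun x => ?_
          have : ‖g x‖ₑ ^ u = ‖g x‖ₑ ^ (u - 1) * ‖g x‖ₑ := by
            conv_rhs => rw [← ENNReal.rpow_one (‖g x‖ₑ), ← ENNReal.rpow_mul, one_mul]
            rw [← ENNReal.rpow_add_of_nonneg _ _ (by linarith) zero_le_one, sub_add_cancel]
          rw [this]
          gcongr
          exact hA x
      _ = A ^ (u - 1) * ∫⁻ x in Metric.ball y r, ‖g x‖ₑ :=
          lintegral_const_mul'' _ hg.restrict.enorm
      _ ≤ A ^ (u - 1) * B := by
          gcongr
          exact (setLIntegral_le_lintegral _ _).trans hB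
  calc V ^ (1 / u - 1 / p) * (∫⁻ x in Metric.ball y r, ‖g x‖ₑ ^ p) ^ (1 / p)
      ≤ V ^ (1 / u - 1 / p) * (J ^ (p / u) * V ^ (1 - p / u)) ^ (1 / p) := by gcongr
    _ = (V ^ (1 / u - 1 / p) * V ^ ((1 - p / u) * (1 / p))) * J ^ (1 / u) := by
        rw [ENNReal.mul_rpow_of_nonneg _ _ (by positivity), ← ENNReal.rpow_mul, ← ENNReal.rpow_mul]
        have : p / u * (1 / p) = 1 / u := by field_simp
        rw [this]
        ring
    _ = J ^ (1 / u) := by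
        rw [← ENNReal.rpow_add _ _ hV0 hVt]
        have : 1 / u - 1 / p + (1 - p / u) * (1 / p) = 0 := by
          field_simp
          ring
        rw [this, ENNReal.rpow_zero, one_mul]
    _ ≤ (A ^ (u - 1) * B) ^ (1 / u) := by gcongr
    _ = A ^ (1 - 1 / u) * B ^ (1 / u) := by
        rw [ENNReal.mul_rpow_of_nonneg _ _ (by positivity), ← ENNReal.rpow_mul]
        congr 2
        field_simp

theorem distMorreyNorm_littlewoodPaleyPiece_le (hp : 1 ≤ p) (hpu : p ≤ u)
    {φ₀ : EuclideanSpace ℝ (Fin d) → ℝ} (h : IsDyadicGenerator φ₀) (k : ℕ)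
    {T : 𝓢'(EuclideanSpace ℝ (Fin d), ℂ)} {F : EuclideanSpace ℝ (Fin d) → ℂ}
    (hF : Integrable F) (hT : ∀ φ : 𝓢(EuclideanSpace ℝ (Fin d), ℂ), T φ = ∫ x, φ x * F x)
    {A B : ℝ} (hA : ∀ z, ‖(𝓕 (h.schwartzPiece k)) z‖ ≤ A)
    (hB : ∫ z, ‖(𝓕 (h.schwartzPiece k)) z‖ ≤ B) :
    distMorreyNorm p u (littlewoodPaleyPiece φ₀ T k) ≤
      ENNReal.ofReal (A * ∫ x, ‖F x‖) ^ (1 - 1 / u) *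
        ENNReal.ofReal (B * ∫ x, ‖F x‖) ^ (1 / u) := by
  obtain ⟨h1, h2, h3⟩ := integral_kernel_bounds (𝓕 (h.schwartzPiece k)) hF hA hB
  refine iInf_le_of_le _ (iInf_le_of_le (represents_littlewoodPaleyPiece h k hF hT) ?_)
  refine morreyNorm_le_of_bounded hp hpu h1.aestronglyMeasurable (fun x => ?_) ?_
  · rw [← ofReal_norm]
    exact ENNReal.ofReal_le_ofReal (h2 x)
  · simp_rw [← ofReal_norm]
    rw [← ofReal_integral_eq_lintegral_ofReal h1.norm (ae_of_all _ fun _ => norm_nonneg _)]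
    exact ENNReal.ofReal_le_ofReal h3

theorem distMorreyNorm_littlewoodPaleyPiece_lt_top (hp : 1 ≤ p) (hpu : p ≤ u)
    {φ₀ : EuclideanSpace ℝ (Fin d) → ℝ} (h : IsDyadicGenerator φ₀) (k : ℕ)
    {T : 𝓢'(EuclideanSpace ℝ (Fin d), ℂ)} {F : EuclideanSpace ℝ (Fin d) → ℂ}
    (hF : Integrable F) (hT : ∀ φ : 𝓢(EuclideanSpace ℝ (Fin d), ℂ), T φ = ∫ x, φ x * F x) :
    distMorreyNorm p u (littlewoodPaleyPiece φ₀ T k) < ∞ := by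
  have hu : 1 ≤ u := hp.trans hpu
  have hu0 : 0 < u := by linarith
  refine (distMorreyNorm_littlewoodPaleyPiece_le hp hpu h k hF hT
    (fun z => SchwartzMap.norm_le_seminorm ℝ _ z) le_rfl).trans_lt (ENNReal.mul_lt_top ?_ ?_)
  · refine ENNReal.rpow_lt_top_of_nonneg ?_ ENNReal.ofReal_ne_top
    rw [sub_nonneg, div_le_one hu0]; exact hu
  · exact ENNReal.rpow_lt_top_of_nonneg (by positivity) ENNReal.ofReal_ne_top

theorem distMorreyNorm_zero (hp : 0 < p) :
    distMorreyNorm p u (0 : 𝓢'(EuclideanSpace ℝ (Fin d), ℂ)) = 0 := by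
  refine le_antisymm (iInf_le_of_le 0 (iInf_le_of_le ⟨locallyIntegrable_zero, fun φ _ => ?_⟩ ?_))
    zero_le
  · simp
  · refine iSup_le fun y => iSup_le fun r => iSup_le fun hr => ?_
    simp [hp]

end Upper

/-! ### Band-limited profiles and detection of kinks on the line -/

section OneDim

/-- A smooth bump function on the line as a Schwartz function. -/
noncomputable def bumpSchwartz {c : ℝ} (b : ContDiffBump c) : 𝓢(ℝ, ℂ) :=
  HasCompactSupport.toSchwartzMap (f := fun t => (b t : ℂ))
    (b.hasCompactSupport.comp_left Complex.ofReal_zero)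
    (Complex.ofRealCLM.contDiff.comp b.contDiff)

theorem bumpSchwartz_apply {c : ℝ} (b : ContDiffBump c) (t : ℝ) : bumpSchwartz b t = (b t : ℂ) :=
  rfl

theorem fourier_bumpSchwartz_zero {c : ℝ} (b : ContDiffBump c) :
    (𝓕 (bumpSchwartz b)) 0 = ((∫ t, b t : ℝ) : ℂ) := by
  rw [SchwartzMap.fourier_coe, Real.fourier_real_eq_integral_exp_smul]
  simp only [mul_zero, Complex.ofReal_zero, zero_mul, Complex.exp_zero, one_smul,
    bumpSchwartz_apply]
  exact integral_ofReal

/-- A real even function has a real Fourier transform. -/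
theorem conj_fourier_bumpSchwartz (b : ContDiffBump (0 : ℝ)) (t : ℝ) :
    (starRingEnd ℂ) ((𝓕 (bumpSchwartz b)) t) = (𝓕 (bumpSchwartz b)) t := by
  have h1 : (starRingEnd ℂ) ((𝓕 (bumpSchwartz b)) t) = 𝓕⁻ (bumpSchwartz b : ℝ → ℂ) t := by
    rw [SchwartzMap.fourier_coe, Real.fourier_real_eq_integral_exp_smul, ← integral_conj,
      Real.fourierInv_eq']
    refine integral_congr_ae (ae_of_all _ fun x => ?_)
    simp only [smul_eq_mul, map_mul, bumpSchwartz_apply, Complex.conj_ofReal, ← Complex.exp_conj,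
      Complex.conj_I, RCLike.inner_apply, conj_trivial]
    congr 2
    push_cast
    ring
  rw [h1, Real.fourierInv_eq_fourier_comp_neg, SchwartzMap.fourier_coe]
  refine congrArg _ (funext fun x => ?_)
  simp only [bumpSchwartz_apply, b.neg]

theorem fourier_fourier_apply (f : 𝓢(ℝ, ℂ)) (x : ℝ) :
    (𝓕 (𝓕 f : 𝓢(ℝ, ℂ))) x = f (-x) := by
  have h : (𝓕⁻ (𝓕 f : 𝓢(ℝ, ℂ))) (-x) = f (-x) := by
    rw [FourierTransform.fourierInv_fourier_eq]
  rw [SchwartzMap.fourierInv_coe, Real.fourierInv_eq_fourier_neg, neg_neg] at h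
  rw [SchwartzMap.fourier_coe (𝓕 f), h]

theorem one_add_norm_pow_mul_le {E : Type*} [NormedAddCommGroup E] [NormedSpace ℝ E]
    (f : 𝓢(E, ℂ)) (k : ℕ) : ∃ C, 0 ≤ C ∧ ∀ x, (1 + ‖x‖) ^ k * ‖f x‖ ≤ C := by
  have h : ∀ x, (1 + ‖x‖) ^ k * ‖f x‖ ≤ _ := fun x => by
    simpa using SchwartzMap.one_add_le_sup_seminorm_apply (𝕜 := ℝ) (m := (k, 0)) (k := k) (n := 0)
      le_rfl le_rfl f x
  exact ⟨_, le_trans (by positivity) (h 0), h⟩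

/-- A nonnegative band-limited function on the line, not vanishing at the origin. -/
structure IsBandLimitedProfile (ε : ℝ) (g : ℝ → ℝ) : Prop where
  continuous : Continuous g
  nonneg : ∀ t, 0 ≤ g t
  pos_zero : 0 < g 0
  decay : ∃ C, 0 ≤ C ∧ ∀ t, (1 + |t|) ^ 4 * g t ≤ C
  fourier_eq_zero : ∀ ξ, ε < |ξ| → 𝓕 (fun t => (g t : ℂ)) ξ = 0
  fourier_mul_eq_zero : ∀ ξ, ε < |ξ| → 𝓕 (fun t => ((t * g t : ℝ) : ℂ)) ξ = 0

/-- Take `g` to be the squared transform of an even bump supported in `[-ε/2, ε/2]`. The transform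
is real, so the square is nonnegative; it is the transform of the bump convolved with itself, which
lives in `[-ε, ε]`; and `g 0` is the squared integral of the bump. -/
theorem exists_isBandLimitedProfile {ε : ℝ} (hε : 0 < ε) : ∃ g, IsBandLimitedProfile ε g := by
  let b : ContDiffBump (0 : ℝ) := ⟨ε / 4, ε / 2, by linarith, by linarith⟩
  set c : 𝓢(ℝ, ℂ) := SchwartzMap.convolution (ContinuousLinearMap.mul ℂ ℂ)
    (bumpSchwartz b) (bumpSchwartz b) with hc
  have hcz : ∀ x, ε < |x| → c x = 0 := by
    intro x hx
    rw [hc, SchwartzMap.convolution_apply, convolution_def]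
    refine integral_eq_zero_of_ae (ae_of_all _ fun t => ?_)
    simp only [bumpSchwartz_apply, ContinuousLinearMap.mul_apply', Pi.zero_apply]
    rcases le_or_gt (ε / 2) |t| with ht | ht
    · rw [b.zero_of_le_dist (by simpa [b] using ht)]
      simp
    · have : ε / 2 ≤ |x - t| := by
        have := abs_sub_abs_le_abs_sub x t
        linarith
      rw [b.zero_of_le_dist (x := x - t) (by simpa [b] using this)]
      simp
  set g : ℝ → ℝ := fun t => ‖(𝓕 (bumpSchwartz b)) t‖ ^ 2 with hg
  have hgc : ∀ t, ((g t : ℝ) : ℂ) = (𝓕 c) t := by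
    intro t
    rw [hc, SchwartzMap.fourier_convolution, SchwartzMap.pairing_apply_apply,
      ContinuousLinearMap.mul_apply', hg]
    conv_rhs => rw [← conj_fourier_bumpSchwartz b t]
    rw [conj_fourier_bumpSchwartz b t]
    nth_rewrite 1 [← conj_fourier_bumpSchwartz b t]
    rw [mul_comm, Complex.mul_conj, Complex.normSq_eq_norm_sq]
  have hgn : ∀ t, g t = ‖(𝓕 c) t‖ := by
    intro t
    rw [← hgc, Complex.norm_real, Real.norm_of_nonneg (by positivity)]
  obtain ⟨C, hC0, hC⟩ := one_add_norm_pow_mul_le (𝓕 c) 4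
  refine ⟨g, ⟨?_, fun t => by positivity, ?_, ⟨C, hC0, fun t => ?_⟩, fun ξ hξ => ?_,
    fun ξ hξ => ?_⟩⟩
  · exact ((𝓕 (bumpSchwartz b)).continuous.norm).pow 2
  · rw [hg]
    simp only [fourier_bumpSchwartz_zero, Complex.norm_real]
    exact pow_pos (norm_pos_iff.2 b.integral_pos.ne') 2
  · rw [hgn]
    exact hC t
  · simp_rw [hgc]
    rw [← SchwartzMap.fourier_coe, fourier_fourier_apply]
    exact hcz _ (by rwa [abs_neg])
  -- Up to the factor `2πi`, `t g(t)` is the transform of `c'`, and `c'` vanishes wherever `c` is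
  -- locally zero.
  · have hder : ∀ t, ((t * g t : ℝ) : ℂ)
        = (2 * Real.pi * Complex.I)⁻¹ • (𝓕 (SchwartzMap.derivCLM ℂ ℂ c)) t := by
      intro t
      have h1 : (𝓕 (SchwartzMap.derivCLM ℂ ℂ c)) t = (2 * Real.pi * Complex.I * t) • (𝓕 c) t := by
        have := congrFun (Real.fourier_deriv c.integrable c.differentiable
          (SchwartzMap.derivCLM ℂ ℂ c).integrable) t
        exact this
      rw [h1, ← hgc, smul_eq_mul, smul_eq_mul]
      have hpi : (Real.pi : ℂ) ≠ 0 := Complex.ofReal_ne_zero.2 Real.pi_ne_zero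
      have hI := Complex.I_ne_zero
      push_cast
      field_simp
    simp_rw [hder]
    have h2 : (fun t => (2 * Real.pi * Complex.I)⁻¹ • (𝓕 (SchwartzMap.derivCLM ℂ ℂ c)) t)
        = ⇑((2 * Real.pi * Complex.I)⁻¹ • 𝓕 (SchwartzMap.derivCLM ℂ ℂ c)) := by
      ext t
      simp
    rw [h2, ← SchwartzMap.fourier_coe, FourierTransform.fourier_smul, smul_apply,
      fourier_fourier_apply, SchwartzMap.derivCLM_apply]
    have h3 : (c : ℝ → ℂ) =ᶠ[𝓝 (-ξ)] fun _ => 0 := by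
      have : IsOpen {x : ℝ | ε < |x|} := isOpen_lt continuous_const continuous_abs
      filter_upwards [this.mem_nhds (show -ξ ∈ {x : ℝ | ε < |x|} by simpa using hξ)] with y hy
      exact hcz y hy
    rw [h3.deriv_eq]
    simp

/-- The second derivatives of `max t 0` and `|t|` are `δ` and `2δ`. Against `Φ''` they yield `Φ 0`
and `2 Φ 0`, and `Φ 0 > 0` when `Φ` is the transform of a bump. Passing to `Φ''` multiplies that
bump by `(2πiξ)²`, which does not enlarge its support. -/
theorem exists_schwartz_kink_integral_ne_zero : ∃ b : 𝓢(ℝ, ℂ),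
    (∀ ξ, b ξ ≠ 0 → 4 / 5 ≤ ξ ∧ ξ ≤ 9 / 10) ∧
    ∫ t : ℝ, ((max t 0 : ℝ) : ℂ) * (𝓕 b) t ≠ 0 ∧ ∫ t : ℝ, ((|t| : ℝ) : ℂ) * (𝓕 b) t ≠ 0 := by
  let B : ContDiffBump (17 / 20 : ℝ) := ⟨1 / 40, 1 / 20, by norm_num, by norm_num⟩
  set Φ : 𝓢(ℝ, ℂ) := 𝓕 (bumpSchwartz B) with hΦ
  set Φ₁ := SchwartzMap.derivCLM ℂ ℂ Φ with hΦ₁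
  set Φ₂ := SchwartzMap.derivCLM ℂ ℂ Φ₁ with hΦ₂
  have hb : (𝓕 (𝓕⁻ Φ₂ : 𝓢(ℝ, ℂ))) = Φ₂ := FourierTransform.fourier_fourierInv_eq _
  have htg : (fun t : ℝ => (t : ℂ)).HasTemperateGrowth := Function.Complex.hasTemperateGrowth_ofReal
  -- `S = t Φ' - Φ` is the primitive of `R = t Φ''`. It decays at both ends, so the half-line
  -- integrals of `R` are read off from `S 0 = -Φ 0`.
  set S : 𝓢(ℝ, ℂ) := SchwartzMap.smulLeftCLM ℂ (fun t : ℝ => (t : ℂ)) Φ₁ - Φ with hS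
  set R : 𝓢(ℝ, ℂ) := SchwartzMap.smulLeftCLM ℂ (fun t : ℝ => (t : ℂ)) Φ₂ with hR
  have hSv : ∀ t, S t = t * Φ₁ t - Φ t := fun t => by
    simp [hS, SchwartzMap.smulLeftCLM_apply_apply htg]
  have hRv : ∀ t, R t = t * Φ₂ t := fun t => by
    simp [hR, SchwartzMap.smulLeftCLM_apply_apply htg]
  have hSd : ∀ t, HasDerivAt S (R t) t := by
    intro t
    have h1 : HasDerivAt (fun t : ℝ => (t : ℂ) * Φ₁ t - Φ t)
        (1 * Φ₁ t + t * Φ₂ t - Φ₁ t) t :=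
      ((HasDerivAt.ofReal_comp (hasDerivAt_id t)).mul (Φ₁.hasDerivAt t)).sub (Φ.hasDerivAt t)
    have h2 : (S : ℝ → ℂ) = fun t : ℝ => (t : ℂ) * Φ₁ t - Φ t := funext hSv
    rw [h2, hRv]
    convert h1 using 1
    ring
  have hS0 : S 0 = - Φ 0 := by simp [hSv]
  have hΦ0 : Φ 0 ≠ 0 := by
    rw [hΦ, fourier_bumpSchwartz_zero]
    exact Complex.ofReal_ne_zero.2 B.integral_pos.ne'
  have hIoi : ∫ t in Set.Ioi (0 : ℝ), R t = Φ 0 := by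
    rw [integral_Ioi_of_hasDerivAt_of_tendsto' (fun t _ => hSd t) R.integrable.integrableOn
      (S.tendsto_cocompact.mono_left atTop_le_cocompact), hS0]
    ring
  have hIic : ∫ t in Set.Iic (0 : ℝ), R t = - Φ 0 := by
    rw [integral_Iic_of_hasDerivAt_of_tendsto' (fun t _ => hSd t) R.integrable.integrableOn
      (S.tendsto_cocompact.mono_left atBot_le_cocompact), hS0]
    ring
  have hmax : ∫ t : ℝ, ((max t 0 : ℝ) : ℂ) * Φ₂ t = Φ 0 := by
    rw [← hIoi, ← integral_indicator measurableSet_Ioi]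
    refine integral_congr_ae (ae_of_all _ fun t => ?_)
    rcases le_or_gt t 0 with ht | ht
    · simp [ht]
    · simp [ht.le, Set.indicator_of_mem (show t ∈ Set.Ioi (0 : ℝ) by simpa using ht), hRv]
  have habs : ∫ t : ℝ, ((|t| : ℝ) : ℂ) * Φ₂ t = 2 * Φ 0 := by
    have h1 : ∀ t : ℝ, ((|t| : ℝ) : ℂ) * Φ₂ t
        = (Set.Ioi (0 : ℝ)).indicator R t - (Set.Iic (0 : ℝ)).indicator R t := by
      intro t
      rcases le_or_gt t 0 with ht | ht
      · rw [Set.indicator_of_notMem (show t ∉ Set.Ioi (0 : ℝ) by simpa using ht),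
          Set.indicator_of_mem (show t ∈ Set.Iic (0 : ℝ) by simpa using ht), abs_of_nonpos ht, hRv]
        push_cast
        ring
      · rw [Set.indicator_of_mem (show t ∈ Set.Ioi (0 : ℝ) by simpa using ht),
          Set.indicator_of_notMem (show t ∉ Set.Iic (0 : ℝ) by simpa using ht), abs_of_pos ht, hRv,
          sub_zero]
    simp_rw [h1]
    rw [integral_sub (R.integrable.indicator measurableSet_Ioi)
      (R.integrable.indicator measurableSet_Iic), integral_indicator measurableSet_Ioi,
      integral_indicator measurableSet_Iic, hIoi, hIic]
    ring
  refine ⟨𝓕⁻ Φ₂, fun ξ hξ => ?_, ?_, ?_⟩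
  · have hder : ∀ (f : 𝓢(ℝ, ℂ)) (x : ℝ), (𝓕 (SchwartzMap.derivCLM ℂ ℂ f)) x
        = (2 * Real.pi * Complex.I * x) • (𝓕 f) x := by
      intro f x
      exact congrFun (Real.fourier_deriv f.integrable f.differentiable
          (SchwartzMap.derivCLM ℂ ℂ f).integrable) x
    have h1 : (𝓕⁻ Φ₂) ξ = (𝓕 Φ₂) (-ξ) := by
      rw [SchwartzMap.fourierInv_coe, Real.fourierInv_eq_fourier_neg]
      rfl
    rw [h1, hΦ₂, hder, hΦ₁, hder, hΦ, fourier_fourier_apply, neg_neg, bumpSchwartz_apply] at hξ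
    have h2 : B ξ ≠ 0 := by
      intro h0
      apply hξ
      simp [h0]
    have h3 : ξ ∈ Function.support B := h2
    rw [B.support_eq, Metric.mem_ball, Real.dist_eq, abs_lt] at h3
    have h4 : B.rOut = 1 / 20 := rfl
    rw [h4] at h3
    constructor <;> linarith [h3.1, h3.2]
  · rw [hb, hmax]
    exact hΦ0
  · rw [hb, habs]
    exact mul_ne_zero two_ne_zero hΦ0

theorem integral_fourier_bumpSchwartz (b : ContDiffBump (0 : ℝ)) :
    ∫ t, (𝓕 (bumpSchwartz b)) t = 1 := by
  have h : (𝓕⁻ (𝓕 (bumpSchwartz b) : 𝓢(ℝ, ℂ))) 0 = bumpSchwartz b 0 := by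
    rw [FourierTransform.fourierInv_fourier_eq]
  rw [SchwartzMap.fourierInv_coe, Real.fourierInv_eq'] at h
  simpa [bumpSchwartz_apply, b.rIn_pos.le,
    b.one_of_mem_closedBall] using h

theorem tendsto_integral_dilate_mul {g : ℝ → ℝ} (hg : Continuous g) {C : ℝ}
    (hC : ∀ t, |g t| ≤ C) {w : ℝ → ℂ} (hw : Integrable w) :
    Tendsto (fun k : ℕ => ∫ t, (g ((2 ^ k)⁻¹ * t) : ℂ) * w t) atTop (𝓝 (g 0 * ∫ t, w t)) := by
  rw [← integral_const_mul]
  refine tendsto_integral_of_dominated_convergence (fun t => C * ‖w t‖) (fun k => ?_)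
    (hw.norm.const_mul C) (fun k => ae_of_all _ fun t => ?_) (ae_of_all _ fun t => ?_)
  · exact (by fun_prop : Continuous fun t => (g ((2 ^ k)⁻¹ * t) : ℂ)).aestronglyMeasurable.mul
      hw.aestronglyMeasurable
  · rw [norm_mul, Complex.norm_real]
    exact mul_le_mul_of_nonneg_right (hC _) (norm_nonneg _)
  · have h1 : Tendsto (fun k : ℕ => ((2 : ℝ) ^ k)⁻¹ * t) atTop (𝓝 0) := by
      have := (tendsto_pow_atTop_nhds_zero_of_lt_one (r := (2⁻¹ : ℝ)) (by norm_num)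
        (by norm_num)).mul_const t
      simpa [inv_pow] using this
    have h2 := (hg.tendsto 0).comp h1
    exact ((Complex.continuous_ofReal.tendsto _).comp h2).mul_const _

end OneDim

/-! ### Product functions and anisotropic dilations -/

section Product

variable {d : ℕ}

theorem integral_euclidean_prod {𝕜 : Type*} [RCLike 𝕜] (h : Fin d → ℝ → 𝕜) :
    ∫ x : EuclideanSpace ℝ (Fin d), ∏ i, h i (x i) = ∏ i, ∫ t, h i t := by
  rw [← (PiLp.volume_preserving_toLp (Fin d)).integral_comp
    (MeasurableEquiv.toLp 2 _).measurableEmbedding]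
  exact integral_fintype_prod_volume_eq_prod h

theorem integrable_euclidean_prod {h : Fin d → ℝ → ℂ} (hh : ∀ i, Integrable (h i)) :
    Integrable fun x : EuclideanSpace ℝ (Fin d) => ∏ i, h i (x i) := by
  rw [← (PiLp.volume_preserving_toLp (Fin d)).integrable_comp_emb
    (MeasurableEquiv.toLp 2 _).measurableEmbedding]
  exact Integrable.fintype_prod hh

theorem fourier_euclidean_prod (h : Fin d → ℝ → ℂ) (ξ : EuclideanSpace ℝ (Fin d)) :
    𝓕 (fun x : EuclideanSpace ℝ (Fin d) => ∏ i, h i (x i)) ξ = ∏ i, 𝓕 (h i) (ξ i) := by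
  rw [Real.fourier_eq']
  simp_rw [Real.fourier_real_eq_integral_exp_smul]
  rw [← integral_euclidean_prod]
  refine integral_congr_ae (ae_of_all _ fun x => ?_)
  simp only [smul_eq_mul]
  rw [Finset.prod_mul_distrib, ← Complex.exp_sum]
  congr 2
  rw [← Finset.sum_mul, PiLp.inner_apply]
  congr 1
  rw [← Complex.ofReal_sum, Finset.mul_sum]
  congr 1
  refine Finset.sum_congr rfl fun i _ => ?_
  simp only [RCLike.inner_apply, conj_trivial]
  ring

theorem fourier_comp_inv_mul (f : ℝ → ℂ) {a : ℝ} (ha : 0 < a) (ξ : ℝ) :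
    𝓕 (fun t => f (a⁻¹ * t)) ξ = a * 𝓕 f (a * ξ) := by
  rw [Real.fourier_real_eq_integral_exp_smul, Real.fourier_real_eq_integral_exp_smul]
  have h := Measure.integral_comp_mul_left
    (fun t : ℝ => Complex.exp (↑(-2 * Real.pi * t * (a * ξ)) * Complex.I) • f t) a⁻¹
  rw [inv_inv, abs_of_pos ha] at h
  rw [← Complex.real_smul, ← h]
  refine integral_congr_ae (ae_of_all _ fun t => ?_)
  simp only
  congr 4
  field_simp

theorem euclidean_norm_le_sum (x : EuclideanSpace ℝ (Fin d)) : ‖x‖ ≤ ∑ i, |x i| := by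
  rw [EuclideanSpace.norm_eq]
  refine Real.sqrt_le_iff.2 ⟨Finset.sum_nonneg fun _ _ => abs_nonneg _, ?_⟩
  simp only [Real.norm_eq_abs]
  exact Finset.sum_sq_le_sq_sum_of_nonneg fun _ _ => abs_nonneg _

theorem one_add_sum_le_prod {ι : Type*} (s : Finset ι) {a : ι → ℝ} (ha : ∀ i, 0 ≤ a i) :
    1 + ∑ i ∈ s, a i ≤ ∏ i ∈ s, (1 + a i) := by
  classical
  induction s using Finset.induction_on with
  | empty => simp
  | insert i s hi ih =>
    rw [Finset.sum_insert hi, Finset.prod_insert hi]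
    have h1 : 0 ≤ ∑ i ∈ s, a i := Finset.sum_nonneg fun _ _ => ha _
    calc 1 + (a i + ∑ i ∈ s, a i) ≤ (1 + a i) * (1 + ∑ i ∈ s, a i) := by
          nlinarith [mul_nonneg (ha i) h1]
      _ ≤ _ := mul_le_mul_of_nonneg_left ih (by linarith [ha i])

/-- The product of dilated Fourier transforms of functions of one variable. -/
noncomputable def prodTest (b : Fin d → 𝓢(ℝ, ℂ)) (k : Fin d → ℕ)
    (x : EuclideanSpace ℝ (Fin d)) : ℂ :=
  ∏ i, (((2 : ℝ) ^ k i : ℝ) : ℂ) * (𝓕 (b i)) (2 ^ k i * x i)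

theorem exists_fourier_eq_prodTest (b : Fin d → 𝓢(ℝ, ℂ))
    (hb : ∀ i, ∃ R, ∀ ξ, b i ξ ≠ 0 → |ξ| ≤ R) (k : Fin d → ℕ) :
    ∃ B : 𝓢(EuclideanSpace ℝ (Fin d), ℂ), (∀ ξ, B ξ = ∏ i, b i ((2 ^ k i)⁻¹ * ξ i)) ∧
      ∀ x, (𝓕 B) x = prodTest b k x := by
  choose R hR using hb
  have hR' : ∀ i t, R i < |t| → b i t = 0 := fun i t ht => by
    by_contra h0
    exact absurd (hR i t h0) (not_le.2 ht)
  set f : EuclideanSpace ℝ (Fin d) → ℂ := fun ξ => ∏ i, b i ((2 ^ k i)⁻¹ * ξ i) with hf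
  have hsupp : HasCompactSupport f := by
    refine HasCompactSupport.intro (isCompact_closedBall 0 (∑ i, 2 ^ k i * |R i|)) fun ξ hξ => ?_
    rw [mem_closedBall_zero_iff, not_le] at hξ
    obtain ⟨i, -, hi⟩ := Finset.exists_lt_of_sum_lt (hξ.trans_le (euclidean_norm_le_sum ξ))
    refine Finset.prod_eq_zero (Finset.mem_univ i) (hR' i _ ?_)
    rw [abs_mul, abs_of_pos (by positivity), lt_inv_mul_iff₀ (by positivity)]
    exact lt_of_le_of_lt (mul_le_mul_of_nonneg_left (le_abs_self _) (by positivity)) hi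
  have hsmooth : ContDiff ℝ (⊤ : ℕ∞) f := by
    refine contDiff_prod fun i _ => ((b i).smooth ⊤).comp (contDiff_const.mul ?_)
    exact (EuclideanSpace.proj (𝕜 := ℝ) i).contDiff
  refine ⟨hsupp.toSchwartzMap hsmooth, fun ξ => rfl, fun x => ?_⟩
  have h1 : (𝓕 (hsupp.toSchwartzMap hsmooth)) x = 𝓕 f x := rfl
  rw [h1, hf, fourier_euclidean_prod (fun i t => b i ((2 ^ k i)⁻¹ * t)), prodTest]
  refine Finset.prod_congr rfl fun i _ => ?_
  rw [fourier_comp_inv_mul _ (by positivity)]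
  rfl

theorem integral_norm_prodTest (b : Fin d → 𝓢(ℝ, ℂ)) (k : Fin d → ℕ) :
    ∫ x, ‖prodTest b k x‖ = ∏ i, ∫ t, ‖(𝓕 (b i)) t‖ := by
  simp only [prodTest, norm_prod]
  refine (integral_euclidean_prod
    (fun i t => ‖(((2 : ℝ) ^ k i : ℝ) : ℂ) * (𝓕 (b i)) (2 ^ k i * t)‖)).trans ?_
  refine Finset.prod_congr rfl fun i _ => ?_
  simp only [norm_mul, Complex.norm_real]
  rw [integral_const_mul, Measure.integral_comp_mul_left (fun t : ℝ => ‖(𝓕 (b i) : 𝓢(ℝ, ℂ)) t‖),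
    Real.norm_of_nonneg (by positivity), abs_of_pos (by positivity), smul_eq_mul,
    mul_inv_cancel_left₀ (by positivity)]

/-- The function is concentrated on a box whose sides are at most `2^(-l)`, so it decays
isotropically at that scale. The product of the one-dimensional weights dominates the isotropic
weight, and `C` depends on neither `k` nor `l`. -/
theorem prodTest_decay (b : Fin d → 𝓢(ℝ, ℂ)) (m : ℕ) :
    ∃ C, 0 ≤ C ∧ ∀ (k : Fin d → ℕ) (l : ℕ), (∀ i, l ≤ k i) → ∀ x,
      (1 + ‖x‖ / (2 ^ l)⁻¹) ^ m * ‖prodTest b k x‖ ≤ C * 2 ^ ∑ i, k i := by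
  choose C hC0 hC using fun i => one_add_norm_pow_mul_le (𝓕 (b i)) m
  refine ⟨∏ i, C i, Finset.prod_nonneg fun i _ => hC0 i, fun k l hl x => ?_⟩
  have h1 : 1 + ‖x‖ / (2 ^ l)⁻¹ ≤ ∏ i, (1 + |2 ^ k i * x i|) := by
    refine le_trans ?_ (one_add_sum_le_prod _ fun i => abs_nonneg _)
    rw [div_inv_eq_mul, mul_comm]
    gcongr
    calc 2 ^ l * ‖x‖ ≤ 2 ^ l * ∑ i, |x i| := by gcongr; exact euclidean_norm_le_sum x
      _ = ∑ i, 2 ^ l * |x i| := Finset.mul_sum _ _ _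
      _ ≤ ∑ i, |2 ^ k i * x i| := by
        refine Finset.sum_le_sum fun i _ => ?_
        rw [abs_mul, abs_of_pos (by positivity : (0 : ℝ) < 2 ^ k i)]
        gcongr
        · exact one_le_two
        · exact hl i
  calc (1 + ‖x‖ / (2 ^ l)⁻¹) ^ m * ‖prodTest b k x‖
      ≤ (∏ i, (1 + |2 ^ k i * x i|)) ^ m * ‖prodTest b k x‖ := by gcongr
    _ = ∏ i, 2 ^ k i * ((1 + ‖(2 ^ k i * x i : ℝ)‖) ^ m * ‖(𝓕 (b i)) (2 ^ k i * x i)‖) := by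
        rw [prodTest, norm_prod, ← Finset.prod_pow, ← Finset.prod_mul_distrib]
        refine Finset.prod_congr rfl fun i _ => ?_
        rw [norm_mul, Complex.norm_real, Real.norm_of_nonneg (by positivity : (0 : ℝ) ≤ 2 ^ k i),
          Real.norm_eq_abs]
        ring
    _ ≤ ∏ i, 2 ^ k i * C i := by
        refine Finset.prod_le_prod (fun i _ => by positivity) fun i _ => ?_
        exact mul_le_mul_of_nonneg_left (hC i _) (by positivity)
    _ = (∏ i, C i) * 2 ^ ∑ i, k i := by
        rw [Finset.prod_mul_distrib, Finset.prod_pow_eq_pow_sum, mul_comm]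

end Product

/-! ### Lower bounds for Littlewood-Paley pieces by anisotropic test functions -/

section Test

variable {n : ℕ} {p u : ℝ}

/-- The frequency profiles of an anisotropic test function. -/
noncomputable def testProfiles (n : ℕ) (b₀ b₁ : 𝓢(ℝ, ℂ)) : Fin (n + 1) → 𝓢(ℝ, ℂ) :=
  Fin.cons b₀ fun _ => b₁

/-- The dilation exponents of an anisotropic test function. -/
def testScales (n k l : ℕ) : Fin (n + 1) → ℕ := Fin.cons k fun _ => l

theorem sum_testScales (n k l : ℕ) : ∑ i, testScales n k l i = k + n * l := by
  simp [testScales, Fin.sum_univ_succ]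

theorem prodTest_testProfiles (b₀ b₁ : 𝓢(ℝ, ℂ)) (k l : ℕ) (x : EuclideanSpace ℝ (Fin (n + 1))) :
    prodTest (testProfiles n b₀ b₁) (testScales n k l) x =
      ((((2 : ℝ) ^ k : ℝ) : ℂ) * (𝓕 b₀) (2 ^ k * x 0)) *
        ∏ i : Fin n, ((((2 : ℝ) ^ l : ℝ) : ℂ) * (𝓕 b₁) (2 ^ l * x i.succ)) := by
  simp [prodTest, testProfiles, testScales, Fin.prod_univ_succ]

/-- Duality on a ball of radius `2^(-l)`, whose volume is of order `2^(-l(n+1))`. The test function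
has height of order `2^(k+1+nl)` and an `L₁` norm independent of the scales, so the cost is
`(2^(k+1+nl) 2^(-l(n+1)(1-p/u)))^(1/p)`, which is the stated power of `2`. -/
theorem exists_test_lower_bound (hp : 1 ≤ p) (hpu : p ≤ u) {b₀ b₁ : 𝓢(ℝ, ℂ)}
    (hb₀ : ∀ ξ, b₀ ξ ≠ 0 → 4 / 5 ≤ ξ ∧ ξ ≤ 9 / 10)
    (hb₁ : ∀ ξ, b₁ ξ ≠ 0 → |ξ| ≤ 1 / (10 * (n + 1))) :
    ∃ A : ℝ≥0∞, A ≠ 0 ∧ A ≠ ∞ ∧ ∀ k l : ℕ, l ≤ k + 1 →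
      ∃ Ψ : 𝓢(EuclideanSpace ℝ (Fin (n + 1)), ℂ),
        (∀ x, Ψ x = prodTest (testProfiles n b₀ b₁) (testScales n (k + 1) l) x) ∧
        ∀ φ₀ : EuclideanSpace ℝ (Fin (n + 1)) → ℝ, IsDyadicGenerator φ₀ → ∀ T,
          ‖T Ψ‖ₑ ≤ A * 2 ^ (((k + 1 : ℕ) - l : ℝ) / p + l * ((n + 1 : ℕ) / u)) *
            distMorreyNorm p u (littlewoodPaleyPiece φ₀ T (k + 1)) := by
  have hp0 : 0 < p := by linarith
  have hu0 : 0 < u := by linarith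
  have hp1 : 0 ≤ 1 - 1 / p := by
    rw [sub_nonneg, div_le_one hp0]; exact hp
  have hpu1 : 0 ≤ 1 - p / u := by
    rw [sub_nonneg, div_le_one hu0]; exact hpu
  set b := testProfiles n b₀ b₁ with hb
  have hbR : ∀ i, ∃ R, ∀ ξ, b i ξ ≠ 0 → |ξ| ≤ R := by
    intro i
    refine Fin.cases ?_ (fun i => ?_) i
    · refine ⟨9 / 10, fun ξ hξ => ?_⟩
      have := hb₀ ξ hξ
      rw [abs_of_nonneg (by linarith [this.1])]
      exact this.2
    · exact ⟨_, hb₁⟩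
  obtain ⟨C, hC0, hC⟩ := prodTest_decay b (n + 1 + 1)
  set I : ℝ≥0∞ := ENNReal.ofReal (∏ i, ∫ t, ‖(𝓕 (b i)) t‖) with hI
  set V : ℝ≥0∞ := volume (Metric.ball (0 : EuclideanSpace ℝ (Fin (n + 1))) 1) with hV
  have hVt : V ≠ ∞ := measure_ball_lt_top.ne
  set A : ℝ≥0∞ := I ^ (1 - 1 / p) *
    (ENNReal.ofReal (2 ^ (n + 1 + 1) * C) * 2 * V ^ (1 - p / u)) ^ (1 / p) with hA
  have hAt : A ≠ ∞ := by
    refine ENNReal.mul_ne_top (ENNReal.rpow_ne_top_of_nonneg hp1 ENNReal.ofReal_ne_top)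
      (ENNReal.rpow_ne_top_of_nonneg (by positivity) (ENNReal.mul_ne_top
        (ENNReal.mul_ne_top ENNReal.ofReal_ne_top (by simp))
        (ENNReal.rpow_ne_top_of_nonneg hpu1 hVt)))
  -- `A` may vanish if a profile is zero; adding `1` allows division by the constant.
  refine ⟨A + 1, by simp, by simpa using hAt, fun k l hl => ?_⟩
  obtain ⟨B, hB, hBΨ⟩ := exists_fourier_eq_prodTest b hbR (testScales n (k + 1) l)
  refine ⟨𝓕 B, hBΨ, fun φ₀ h T => ?_⟩
  have hscale : ∀ i, l ≤ testScales n (k + 1) l i := fun i =>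
    Fin.cases (by simpa [testScales] using hl) (fun i => by simp [testScales]) i
  -- The window fits the annulus: `(4/5) 2^(k+1) ≥ (3/2) 2^k`, while the transverse frequencies add
  -- at most `(1/10) 2^(k+1)` to `(9/10) 2^(k+1)`, because `l ≤ k + 1`.
  have hsupp : ∀ ξ, B ξ ≠ 0 → dyadicPiece φ₀ (k + 1) ξ = 1 := by
    intro ξ hξ
    rw [hB, Finset.prod_ne_zero_iff] at hξ
    have h0 := hb₀ _ (hξ 0 (Finset.mem_univ _))
    have h1 : ∀ i : Fin n, |ξ i.succ| ≤ 2 ^ (k + 1) * (1 / (10 * (n + 1))) := by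
      intro i
      have h2 := hb₁ _ (hξ i.succ (Finset.mem_univ _))
      simp only [testScales, Fin.cons_succ] at h2
      rw [abs_mul, abs_of_pos (by positivity), inv_mul_le_iff₀ (by positivity)] at h2
      refine h2.trans ?_
      gcongr
      exact one_le_two
    simp only [testScales, Fin.cons_zero] at h0
    rw [le_inv_mul_iff₀ (by positivity), inv_mul_le_iff₀ (by positivity)] at h0
    have h2k : (0 : ℝ) < 2 ^ k := by positivity
    rw [pow_succ] at h0
    have hξ0 : 0 ≤ ξ 0 := by nlinarith [h0.1]
    refine h.dyadicPiece_eq_one k ?_ ?_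
    · have h3 : |ξ 0| ≤ ‖ξ‖ := by simpa using PiLp.norm_apply_le ξ 0
      rw [abs_of_nonneg hξ0] at h3
      nlinarith [h0.1]
    · refine (euclidean_norm_le_sum ξ).trans ?_
      rw [Fin.sum_univ_succ, abs_of_nonneg hξ0]
      have h4 : ∑ i : Fin n, |ξ i.succ| ≤ n * (2 ^ (k + 1) * (1 / (10 * (n + 1)))) := by
        refine (Finset.sum_le_sum fun i _ => h1 i).trans (le_of_eq ?_)
        simp
      have h5 : (n : ℝ) * (2 ^ (k + 1) * (1 / (10 * (n + 1)))) ≤ 2 ^ (k + 1) * (1 / 10) := by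
        rw [mul_left_comm]
        refine mul_le_mul_of_nonneg_left ?_ (by positivity)
        rw [mul_one_div, div_le_div_iff₀ (by positivity) (by positivity)]
        linarith
      rw [pow_succ] at h4 h5 ⊢
      linarith [h0.2]
  rw [← h.littlewoodPaleyPiece_apply_fourier (k + 1) T B hsupp]
  set D := distMorreyNorm p u (littlewoodPaleyPiece φ₀ T (k + 1)) with hD
  have hdecay : ∀ x, (1 + ‖x‖ / (2 ^ l)⁻¹) ^ (n + 1 + 1) * ‖(𝓕 B) x‖
      ≤ C * 2 ^ ∑ i, testScales n (k + 1) l i := fun x => by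
    rw [hBΨ]
    exact hC _ l hscale x
  have key := enorm_apply_div_le_distMorreyNorm (u := u) hp hpu
    (littlewoodPaleyPiece φ₀ T (k + 1)) (𝓕 B) (r := (2 ^ l)⁻¹) (by positivity) hdecay
  have hIval : ∫⁻ x, ‖(𝓕 B) x‖ₑ = I := by
    simp_rw [← ofReal_norm]
    rw [← ofReal_integral_eq_lintegral_ofReal (𝓕 B).integrable.norm
      (ae_of_all _ fun _ => norm_nonneg _), hI, ← integral_norm_prodTest b (testScales n (k + 1) l)]
    simp_rw [hBΨ]
  set e : ℝ := ((k + 1 : ℕ) - l : ℝ) / p + l * ((n + 1 : ℕ) / u) with he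
  have hdenom : (∫⁻ x, ‖(𝓕 B) x‖ₑ) ^ (1 - 1 / p) *
      (ENNReal.ofReal (2 ^ (n + 1 + 1) * (C * 2 ^ ∑ i, testScales n (k + 1) l i)) * 2 *
        volume (Metric.ball (0 : EuclideanSpace ℝ (Fin (n + 1))) (2 ^ l)⁻¹) ^ (1 - p / u)) ^ (1 / p)
      = A * 2 ^ e := by
    have hvol : volume (Metric.ball (0 : EuclideanSpace ℝ (Fin (n + 1))) (2 ^ l)⁻¹)
        = (2 : ℝ≥0∞) ^ (-(l * (n + 1 : ℕ) : ℝ)) * V := by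
      rw [Measure.addHaar_ball_of_pos _ _ (by positivity), finrank_euclideanSpace_fin]
      congr 1
      rw [← inv_pow, ← pow_mul, ENNReal.ofReal_pow (by positivity),
        ENNReal.ofReal_inv_of_pos two_pos, ENNReal.ofReal_ofNat, ENNReal.rpow_neg,
        ← Nat.cast_mul, ENNReal.rpow_natCast, ENNReal.inv_pow]
    have hC2 : ENNReal.ofReal (2 ^ (n + 1 + 1) * (C * 2 ^ ∑ i, testScales n (k + 1) l i))
        = ENNReal.ofReal (2 ^ (n + 1 + 1) * C) * (2 : ℝ≥0∞) ^ ((k + 1 : ℕ) + n * l : ℝ) := by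
      rw [← mul_assoc, ENNReal.ofReal_mul (by positivity), sum_testScales,
        ENNReal.ofReal_pow (by positivity), ENNReal.ofReal_ofNat, ← ENNReal.rpow_natCast]
      push_cast
      rfl
    rw [hIval, hvol, hC2, ENNReal.mul_rpow_of_nonneg _ _ hpu1, ← ENNReal.rpow_mul]
    set K := ENNReal.ofReal (2 ^ (n + 1 + 1) * C)
    have hre : K * (2 : ℝ≥0∞) ^ ((k + 1 : ℕ) + n * l : ℝ) * 2 *
        ((2 : ℝ≥0∞) ^ (-(l * (n + 1 : ℕ) : ℝ) * (1 - p / u)) * V ^ (1 - p / u))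
        = (K * 2 * V ^ (1 - p / u)) * ((2 : ℝ≥0∞) ^ ((k + 1 : ℕ) + n * l : ℝ) *
          (2 : ℝ≥0∞) ^ (-(l * (n + 1 : ℕ) : ℝ) * (1 - p / u))) := by ring
    rw [hre, ← ENNReal.rpow_add _ _ two_ne_zero (by simp),
      ENNReal.mul_rpow_of_nonneg _ _ (by positivity), ← ENNReal.rpow_mul, ← mul_assoc, hA]
    congr 2
    rw [he]
    push_cast
    field_simp
    ring
  rw [hdenom] at key
  have h2e : (2 : ℝ≥0∞) ^ e ≠ 0 := (ENNReal.rpow_pos two_pos (by simp)).ne'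
  have h2e' : (2 : ℝ≥0∞) ^ e ≠ ∞ := ENNReal.rpow_ne_top_of_ne_zero two_ne_zero (by simp)
  have h6 : ‖(littlewoodPaleyPiece φ₀ T (k + 1)) (𝓕 B)‖ₑ / ((A + 1) * 2 ^ e) ≤ D := by
    refine le_trans (ENNReal.div_le_div_left ?_ _) key
    gcongr
    exact le_self_add
  rw [ENNReal.div_le_iff_le_mul (Or.inl (mul_ne_zero (by simp) h2e))
    (Or.inl (ENNReal.mul_ne_top (by simpa using hAt) h2e'))] at h6
  rwa [mul_comm] at h6

end Test

/-! ### Positively homogeneous functions and band-limited weights -/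

section Kink

/-- A positively homogeneous function of one variable, detected by the frequency profile `b`. -/
structure IsKink (b : 𝓢(ℝ, ℂ)) (κ : ℝ → ℝ) : Prop where
  continuous : Continuous κ
  abs_le : ∀ t, |κ t| ≤ |t|
  map_mul : ∀ c t, 0 ≤ c → κ (c * t) = c * κ t
  integral_ne_zero : ∫ t, (κ t : ℂ) * (𝓕 b) t ≠ 0

theorem IsKink.integrable {b : 𝓢(ℝ, ℂ)} {κ : ℝ → ℝ} (hκ : IsKink b κ) :
    Integrable fun t => (κ t : ℂ) * (𝓕 b) t := by
  refine (((𝓕 b).integrable_pow_mul volume 1)).mono' ?_ (ae_of_all _ fun t => ?_)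
  · exact ((Complex.continuous_ofReal.comp hκ.continuous).mul
      (𝓕 b).continuous).aestronglyMeasurable
  · rw [norm_mul, Complex.norm_real, pow_one]
    exact mul_le_mul_of_nonneg_right (hκ.abs_le t) (norm_nonneg _)

theorem exists_isKink : ∃ b : 𝓢(ℝ, ℂ), (∀ ξ, b ξ ≠ 0 → 4 / 5 ≤ ξ ∧ ξ ≤ 9 / 10) ∧
    IsKink b (fun t => max t 0) ∧ IsKink b (fun t => |t|) := by
  obtain ⟨b, hb, h1, h2⟩ := exists_schwartz_kink_integral_ne_zero
  refine ⟨b, hb, ⟨by fun_prop, fun t => ?_, fun c t hc => ?_, h1⟩,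
    ⟨by fun_prop, fun t => by simp, fun c t hc => ?_, h2⟩⟩
  · rcases le_total t 0 with ht | ht
    · simp [ht]
    · simp [ht]
  · rw [mul_max_of_nonneg _ _ hc, mul_zero]
  · rw [abs_mul, abs_of_nonneg hc]

theorem integral_dilate_mul (ψ F : ℝ → ℂ) {a : ℝ} (ha : 0 < a) :
    ∫ t, (a : ℂ) * ψ (a * t) * F t = ∫ t, ψ t * F (a⁻¹ * t) := by
  have h := Measure.integral_comp_mul_left (fun t : ℝ => ψ t * F (a⁻¹ * t)) a
  have h1 : ∀ t, (a : ℂ) * ψ (a * t) * F t = (a : ℂ) * (ψ (a * t) * F (a⁻¹ * (a * t))) := by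
    intro t
    rw [inv_mul_cancel_left₀ ha.ne', mul_assoc]
  simp_rw [h1]
  rw [integral_const_mul, h, abs_of_pos (inv_pos.2 ha), Complex.real_smul, Complex.ofReal_inv,
    mul_inv_cancel_left₀ (Complex.ofReal_ne_zero.2 ha.ne')]

/-- Homogeneity extracts `a⁻¹`, the full decay of the pairing; the remaining integral converges to a
nonzero limit as `a → ∞` if `g 0 ≠ 0`. -/
theorem IsKink.integral_dilate {b : 𝓢(ℝ, ℂ)} {κ : ℝ → ℝ} (hκ : IsKink b κ) (g : ℝ → ℝ) {a : ℝ}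
    (ha : 0 < a) :
    ∫ t, (a : ℂ) * (𝓕 b) (a * t) * ((κ t * g t : ℝ) : ℂ) =
      (a : ℂ)⁻¹ * ∫ t, (g (a⁻¹ * t) : ℂ) * ((κ t : ℂ) * (𝓕 b) t) := by
  rw [integral_dilate_mul (𝓕 b : 𝓢(ℝ, ℂ)) (fun t => ((κ t * g t : ℝ) : ℂ)) ha,
    ← integral_const_mul]
  refine integral_congr_ae (ae_of_all _ fun t => ?_)
  simp only
  rw [hκ.map_mul _ _ (inv_pos.2 ha).le]
  push_cast
  ring

namespace IsBandLimitedProfile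

variable {ε : ℝ} {g : ℝ → ℝ}

theorem exists_abs_le (hg : IsBandLimitedProfile ε g) : ∃ C, ∀ t, |g t| ≤ C := by
  obtain ⟨C, -, hC⟩ := hg.decay
  refine ⟨C, fun t => ?_⟩
  rw [abs_of_nonneg (hg.nonneg t)]
  refine le_trans (le_mul_of_one_le_left (hg.nonneg t) (one_le_pow₀ ?_)) (hC t)
  linarith [abs_nonneg t]

theorem exists_mul_le (hg : IsBandLimitedProfile ε g) :
    ∃ C, 0 ≤ C ∧ ∀ t, (1 + |t|) * g t ≤ C * (1 + |t|) ^ (-3 : ℝ) := by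
  obtain ⟨C, hC0, hC⟩ := hg.decay
  refine ⟨C, hC0, fun t => ?_⟩
  have h1 : 0 < 1 + |t| := by positivity
  rw [Real.rpow_neg h1.le, ← div_eq_mul_inv, le_div_iff₀ (by positivity)]
  refine le_trans (le_of_eq ?_) (hC t)
  have : (1 + |t|) ^ (3 : ℝ) = (1 + |t|) ^ 3 := by
    rw [← Real.rpow_natCast]
    norm_num
  rw [this]
  ring

theorem integrable_one_add_mul (hg : IsBandLimitedProfile ε g) :
    Integrable fun t => (1 + |t|) * g t := by
  obtain ⟨C, -, hC⟩ := hg.exists_mul_le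
  have h : Integrable fun t : ℝ => C * (1 + ‖t‖) ^ (-3 : ℝ) :=
    (integrable_one_add_norm (by simp)).const_mul C
  refine h.mono' ?_ (ae_of_all _ fun t => ?_)
  · exact ((continuous_const.add continuous_abs).mul hg.continuous).aestronglyMeasurable
  · rw [Real.norm_of_nonneg (mul_nonneg (by positivity) (hg.nonneg t))]
    exact hC t

theorem integrable (hg : IsBandLimitedProfile ε g) : Integrable g := by
  refine hg.integrable_one_add_mul.mono' hg.continuous.aestronglyMeasurable
    (ae_of_all _ fun t => ?_)
  rw [Real.norm_of_nonneg (hg.nonneg t)]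
  exact le_mul_of_one_le_left (hg.nonneg t) (by linarith [abs_nonneg t])

theorem integrable_mul (hg : IsBandLimitedProfile ε g) : Integrable fun t => t * g t := by
  refine hg.integrable_one_add_mul.mono' (continuous_id.mul hg.continuous).aestronglyMeasurable
    (ae_of_all _ fun t => ?_)
  rw [norm_mul, Real.norm_of_nonneg (hg.nonneg t)]
  exact mul_le_mul_of_nonneg_right (by rw [Real.norm_eq_abs]; linarith) (hg.nonneg t)

end IsBandLimitedProfile

end Kink

/-! ### The band-limited example for cases (i) and (ii) -/

section SmoothExample

variable {n : ℕ} {p u : ℝ} {ε : ℝ} {g : ℝ → ℝ}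

/-- The function `x ↦ x₀ ∏ᵢ g(xᵢ)`. -/
noncomputable def linearProfile (n : ℕ) (g : ℝ → ℝ) (x : EuclideanSpace ℝ (Fin (n + 1))) : ℝ :=
  x 0 * g (x 0) * ∏ i : Fin n, g (x i.succ)

theorem ofReal_linearProfile (κ : ℝ → ℝ) (x : EuclideanSpace ℝ (Fin (n + 1))) :
    ((κ (x 0) * g (x 0) * ∏ i : Fin n, g (x i.succ) : ℝ) : ℂ) =
      ∏ i, (Fin.cons (fun t => ((κ t * g t : ℝ) : ℂ)) (fun _ t => (g t : ℂ)) :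
        Fin (n + 1) → ℝ → ℂ) i (x i) := by
  simp [Fin.prod_univ_succ]

/-- The factor multiplying `x 0` is nonnegative, so it passes through `κ` and the variables stay
separated. -/
theorem IsKink.comp_linearProfile {b : 𝓢(ℝ, ℂ)} {κ : ℝ → ℝ} (hκ : IsKink b κ)
    (hg : IsBandLimitedProfile ε g) (x : EuclideanSpace ℝ (Fin (n + 1))) :
    κ (linearProfile n g x) = κ (x 0) * g (x 0) * ∏ i : Fin n, g (x i.succ) := by
  have h : linearProfile n g x = (g (x 0) * ∏ i : Fin n, g (x i.succ)) * x 0 := by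
    rw [linearProfile]
    ring
  rw [h, hκ.map_mul _ _ (mul_nonneg (hg.nonneg _) (Finset.prod_nonneg fun i _ => hg.nonneg _))]
  ring

theorem integrable_linearProfile (hg : IsBandLimitedProfile ε g) :
    Integrable fun x => ((linearProfile n g x : ℝ) : ℂ) := by
  have h : ∀ x : EuclideanSpace ℝ (Fin (n + 1)), ((linearProfile n g x : ℝ) : ℂ) = _ :=
    ofReal_linearProfile (fun t => t)
  simp_rw [h]
  refine integrable_euclidean_prod fun i => Fin.cases ?_ (fun i => ?_) i
  · exact hg.integrable_mul.ofReal
  · exact hg.integrable.ofReal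

theorem fourier_linearProfile_eq_zero (hg : IsBandLimitedProfile (1 / (10 * (n + 1))) g)
    {ξ : EuclideanSpace ℝ (Fin (n + 1))} (hξ : 1 < ‖ξ‖) :
    𝓕 (fun x => ((linearProfile n g x : ℝ) : ℂ)) ξ = 0 := by
  have h : ∀ x : EuclideanSpace ℝ (Fin (n + 1)), ((linearProfile n g x : ℝ) : ℂ) = _ :=
    ofReal_linearProfile (fun t => t)
  simp_rw [h]
  rw [fourier_euclidean_prod]
  -- The coordinate thresholds add up to only `1/10`, so `‖ξ‖ > 1` forces some coordinate beyond its
  -- threshold, where that factor of the transform vanishes.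
  have h1 : ∑ i : Fin (n + 1), 1 / (10 * ((n : ℝ) + 1)) < ∑ i, |ξ i| := by
    refine lt_of_lt_of_le ?_ (euclidean_norm_le_sum ξ)
    refine lt_trans ?_ hξ
    rw [Finset.sum_const, Finset.card_univ, Fintype.card_fin, nsmul_eq_mul, mul_one_div,
      div_lt_one (by positivity)]
    push_cast
    linarith [n.cast_nonneg (α := ℝ)]
  obtain ⟨i, -, hi⟩ := Finset.exists_lt_of_sum_lt h1
  refine Finset.prod_eq_zero (Finset.mem_univ i) ?_
  revert hi
  refine Fin.cases (fun hi => ?_) (fun i hi => ?_) i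
  · exact hg.fourier_mul_eq_zero _ hi
  · exact hg.fourier_eq_zero _ hi

theorem memBesovMorrey_linearProfile (hp : 1 ≤ p) (hpu : p ≤ u) {q : ℝ≥0∞} (hq : 1 ≤ q) (s : ℝ)
    (hg : IsBandLimitedProfile (1 / (10 * (n + 1))) g)
    {φ₀ : EuclideanSpace ℝ (Fin (n + 1)) → ℝ} (h : IsDyadicGenerator φ₀) :
    MemBesovMorrey φ₀ s u p q (linearProfile n g) := by
  have hF := integrable_linearProfile (n := n) hg
  obtain ⟨T, hT⟩ := exists_eq_integral hF
  refine ⟨T, represents_of_eq_integral hF hT, ?_⟩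
  have hz : ∀ k, k ≠ 0 → distMorreyNorm p u (littlewoodPaleyPiece φ₀ T k) = 0 := by
    intro k hk
    obtain ⟨j, rfl⟩ := Nat.exists_eq_succ_of_ne_zero hk
    rw [h.littlewoodPaleyPiece_eq_zero (j + 1) hF hT, distMorreyNorm_zero (by linarith)]
    intro ξ hξ
    refine fourier_linearProfile_eq_zero hg ?_
    by_contra hle
    refine hξ (h.dyadicPiece_eq_zero_of_le j ((not_lt.1 hle).trans (one_le_pow₀ one_le_two)))
  have h0 := distMorreyNorm_littlewoodPaleyPiece_lt_top hp hpu h 0 hF hT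
  unfold besovMorreyNorm
  split_ifs with hqt
  · refine lt_of_le_of_lt (iSup_le (a := distMorreyNorm p u (littlewoodPaleyPiece φ₀ T 0))
      fun k => ?_) h0
    rcases eq_or_ne k 0 with rfl | hk
    · simp
    · rw [hz k hk, mul_zero]
      exact zero_le
  · have hq0 : 0 < q.toReal := ENNReal.toReal_pos (one_pos.trans_le hq).ne' hqt
    refine ENNReal.rpow_lt_top_of_nonneg (by positivity) ?_
    rw [tsum_eq_single 0 fun k hk => by rw [hz k hk, mul_zero, ENNReal.zero_rpow_of_pos hq0]]
    refine ENNReal.rpow_ne_top_of_nonneg hq0.le ?_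
    simpa using h0.ne

theorem IsKink.apply_linearProfile {b₀ b₁ : 𝓢(ℝ, ℂ)} {κ : ℝ → ℝ} (hκ : IsKink b₀ κ)
    (hg : IsBandLimitedProfile ε g) {T : 𝓢'(EuclideanSpace ℝ (Fin (n + 1)), ℂ)}
    (hT : Represents T fun x => ((κ (linearProfile n g x) : ℝ) : ℂ)) {k l : ℕ}
    {Ψ : 𝓢(EuclideanSpace ℝ (Fin (n + 1)), ℂ)}
    (hΨ : ∀ x, Ψ x = prodTest (testProfiles n b₀ b₁) (testScales n k l) x) :
    T Ψ = ((2 : ℂ) ^ k)⁻¹ * (∫ t, (g ((2 ^ k)⁻¹ * t) : ℂ) * ((κ t : ℂ) * (𝓕 b₀) t)) *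
      (∫ t, (g ((2 ^ l)⁻¹ * t) : ℂ) * (𝓕 b₁) t) ^ n := by
  have hint : Integrable fun x => Ψ x * ((κ (linearProfile n g x) : ℝ) : ℂ) := by
    have h1 : Integrable fun x => ((κ (linearProfile n g x) : ℝ) : ℂ) := by
      refine (integrable_linearProfile hg).mono hT.1.aestronglyMeasurable
        (ae_of_all _ fun x => ?_)
      rw [Complex.norm_real, Complex.norm_real]
      exact hκ.abs_le _
    exact h1.bdd_mul Ψ.continuous.aestronglyMeasurable
      (ae_of_all _ fun x => SchwartzMap.norm_le_seminorm ℝ Ψ x)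
  rw [hT.apply_eq_integral Ψ hint]
  have h2 : ∀ x : EuclideanSpace ℝ (Fin (n + 1)), Ψ x * ((κ (linearProfile n g x) : ℝ) : ℂ) =
      ∏ i, (Fin.cons (fun t => (((2 : ℝ) ^ k : ℝ) : ℂ) * (𝓕 b₀) (2 ^ k * t) *
        ((κ t * g t : ℝ) : ℂ))
        (fun _ t => (((2 : ℝ) ^ l : ℝ) : ℂ) * (𝓕 b₁) (2 ^ l * t) * (g t : ℂ)) :
        Fin (n + 1) → ℝ → ℂ) i (x i) := by
    intro x
    rw [hΨ, prodTest_testProfiles, hκ.comp_linearProfile hg, Fin.prod_univ_succ]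
    simp only [Fin.cons_zero, Fin.cons_succ]
    push_cast
    simp only [Finset.prod_mul_distrib]
    ring
  simp_rw [h2]
  rw [integral_euclidean_prod, Fin.prod_univ_succ]
  simp only [Fin.cons_zero, Fin.cons_succ, Finset.prod_const, Finset.card_univ, Fintype.card_fin]
  rw [hκ.integral_dilate g (by positivity : (0 : ℝ) < 2 ^ k),
    integral_dilate_mul (𝓕 b₁ : 𝓢(ℝ, ℂ)) (fun t => (g t : ℂ)) (by positivity : (0 : ℝ) < 2 ^ l)]
  simp only [mul_comm ((𝓕 b₁ : 𝓢(ℝ, ℂ)) _)]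
  push_cast
  rfl

/-- The pairing is `2^(-(k+1))` times two factors with nonzero limits: `α` from the kink and `β`
from each transverse direction. The choice of `l` then selects `1/p` or `(n+1)/u` in the exponent.
-/
theorem exists_linearProfile_lower_bound (hp : 1 ≤ p) (hpu : p ≤ u) {b₀ : 𝓢(ℝ, ℂ)} {κ : ℝ → ℝ}
    (hb₀ : ∀ ξ, b₀ ξ ≠ 0 → 4 / 5 ≤ ξ ∧ ξ ≤ 9 / 10) (hκ : IsKink b₀ κ)
    (hg : IsBandLimitedProfile ε g) :
    ∃ c : ℝ≥0∞, c ≠ 0 ∧ ∃ K : ℕ, ∀ φ₀ : EuclideanSpace ℝ (Fin (n + 1)) → ℝ,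
      IsDyadicGenerator φ₀ → ∀ T : 𝓢'(EuclideanSpace ℝ (Fin (n + 1)), ℂ),
      Represents T (fun x => ((κ (linearProfile n g x) : ℝ) : ℂ)) → ∀ k ≥ K,
        c ≤ 2 ^ ((k + 1 : ℕ) * min (1 + 1 / p) (1 + (n + 1 : ℕ) / u)) *
          distMorreyNorm p u (littlewoodPaleyPiece φ₀ T (k + 1)) := by
  have hε : (0 : ℝ) < 1 / (10 * (n + 1)) := by positivity
  let b : ContDiffBump (0 : ℝ) := ⟨1 / (10 * (n + 1)) / 2, 1 / (10 * (n + 1)), by positivity,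
    half_lt_self hε⟩
  have hb₁ : ∀ ξ, bumpSchwartz b ξ ≠ 0 → |ξ| ≤ 1 / (10 * (n + 1)) := by
    intro ξ hξ
    by_contra hlt
    refine hξ ?_
    rw [bumpSchwartz_apply, b.zero_of_le_dist (by rw [Real.dist_eq, sub_zero]; exact (not_le.1 hlt).le)]
    simp
  obtain ⟨A, hA0, hAt, hA⟩ := exists_test_lower_bound hp hpu hb₀ hb₁
  obtain ⟨M, hM⟩ := hg.exists_abs_le
  have hg0 : (g 0 : ℂ) ≠ 0 := Complex.ofReal_ne_zero.2 hg.pos_zero.ne'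
  set α : ℕ → ℂ := fun k => ∫ t, (g ((2 ^ k)⁻¹ * t) : ℂ) * ((κ t : ℂ) * (𝓕 b₀) t) with hα
  set β : ℕ → ℂ := fun l => ∫ t, (g ((2 ^ l)⁻¹ * t) : ℂ) * (𝓕 (bumpSchwartz b)) t with hβ
  have hαlim := tendsto_integral_dilate_mul hg.continuous hM hκ.integrable
  have hβlim := tendsto_integral_dilate_mul hg.continuous hM (𝓕 (bumpSchwartz b)).integrable
  set a₀ : ℝ := ‖(g 0 : ℂ) * ∫ t, (κ t : ℂ) * (𝓕 b₀) t‖ / 2 with ha₀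
  have ha₀p : 0 < a₀ := half_pos (norm_pos_iff.2 (mul_ne_zero hg0 hκ.integral_ne_zero))
  have hαe : ∀ᶠ k in atTop, a₀ ≤ ‖α k‖ :=
    (hαlim.norm.eventually (lt_mem_nhds (half_lt_self (by linarith)))).mono fun k hk => hk.le
  set a₁ : ℝ := ‖(g 0 : ℂ) * ∫ t, (𝓕 (bumpSchwartz b)) t‖ / 2 with ha₁
  have ha₁p : 0 < a₁ := by
    refine half_pos (norm_pos_iff.2 (mul_ne_zero hg0 ?_))
    rw [integral_fourier_bumpSchwartz]
    exact one_ne_zero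
  have hβe : ∀ᶠ l in atTop, a₁ ≤ ‖β l‖ :=
    (hβlim.norm.eventually (lt_mem_nhds (half_lt_self (by linarith)))).mono fun k hk => hk.le
  obtain ⟨K₁, hK₁⟩ := eventually_atTop.1 hαe
  obtain ⟨K₂, hK₂⟩ := eventually_atTop.1 hβe
  set m : ℝ := min (1 + 1 / p) (1 + (n + 1 : ℕ) / u) with hm
  -- If `1/p` is the smaller, the box stays wide with `l = K₂` fixed, the first scale from which `β`
  -- is known to be bounded below; this only changes the constant `R`. Otherwise the isotropic box
  -- `l = k + 1` is better.
  obtain ⟨l, R, hl, hR⟩ : ∃ (l : ℕ → ℕ) (R : ℝ), (∀ k ≥ K₂, K₂ ≤ l k ∧ l k ≤ k + 1) ∧ ∀ k,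
      ((k + 1 : ℕ) - l k : ℝ) / p + l k * ((n + 1 : ℕ) / u) ≤ (k + 1 : ℕ) * (m - 1) + R := by
    rcases le_total (1 + 1 / p) (1 + ((n + 1 : ℕ) : ℝ) / u) with h | h
    · refine ⟨fun _ => K₂, K₂ * ((n + 1 : ℕ) / u) - K₂ / p, fun k hk =>
        ⟨le_rfl, le_trans hk (Nat.le_succ k)⟩, fun k => le_of_eq ?_⟩
      rw [hm, min_eq_left h]
      ring
    · refine ⟨fun k => k + 1, 0, fun k hk => ⟨le_trans hk (Nat.le_succ k), le_rfl⟩, fun k => le_of_eq ?_⟩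
      rw [hm, min_eq_right h]
      ring
  refine ⟨ENNReal.ofReal (a₀ * a₁ ^ n) / (A * 2 ^ R), ?_, max K₁ K₂, fun φ₀ h T hT k hk => ?_⟩
  · refine (ENNReal.div_pos (ENNReal.ofReal_pos.2 (by positivity)).ne' ?_).ne'
    exact ENNReal.mul_ne_top hAt (ENNReal.rpow_ne_top_of_ne_zero two_ne_zero (by simp))
  obtain ⟨hl1, hl2⟩ := hl k (le_of_max_le_right hk)
  obtain ⟨Ψ, hΨ, hΨT⟩ := hA k (l k) hl2
  have h1 := hΨT φ₀ h T
  rw [hκ.apply_linearProfile hg hT hΨ] at h1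
  set D := distMorreyNorm p u (littlewoodPaleyPiece φ₀ T (k + 1))
  have h2 : ENNReal.ofReal (a₀ * a₁ ^ n) ≤ 2 ^ (k + 1) * ‖((2 : ℂ) ^ (k + 1))⁻¹ * α (k + 1) * β (l k) ^ n‖ₑ := by
    have h3 : (2 : ℝ≥0∞) ^ (k + 1) = ENNReal.ofReal (2 ^ (k + 1)) := by
      rw [ENNReal.ofReal_pow (by positivity), ENNReal.ofReal_ofNat]
    rw [← ofReal_norm, h3, ← ENNReal.ofReal_mul (by positivity)]
    refine ENNReal.ofReal_le_ofReal ?_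
    rw [norm_mul, norm_mul, norm_inv, norm_pow, norm_pow, mul_assoc, Complex.norm_ofNat,
      mul_inv_cancel_left₀ (by positivity)]
    have h4 := hK₁ (k + 1) (by have := le_of_max_le_left hk; omega)
    have h5 := hK₂ (l k) hl1
    gcongr
  refine ENNReal.div_le_of_le_mul (h2.trans ?_)
  have h2R : (2 : ℝ≥0∞) ^ R ≠ ∞ := ENNReal.rpow_ne_top_of_ne_zero two_ne_zero (by simp)
  calc (2 : ℝ≥0∞) ^ (k + 1) * ‖((2 : ℂ) ^ (k + 1))⁻¹ * α (k + 1) * β (l k) ^ n‖ₑ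
      ≤ 2 ^ (k + 1) * (A * 2 ^ ((k + 1 : ℕ) * (m - 1) + R) * D) := by
        gcongr
        refine h1.trans (mul_le_mul_left (mul_le_mul_right ?_ _) _)
        exact ENNReal.rpow_le_rpow_of_exponent_le one_le_two (hR k)
    _ = 2 ^ ((k + 1 : ℕ) * m) * D * (A * 2 ^ R) := by
        have h6 : (2 : ℝ≥0∞) ^ ((k + 1 : ℕ) * m)
            = 2 ^ (k + 1) * 2 ^ ((k + 1 : ℕ) * (m - 1)) := by
          rw [← ENNReal.rpow_natCast, ← ENNReal.rpow_add _ _ two_ne_zero (by simp)]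
          congr 1
          ring
        rw [h6, ENNReal.rpow_add _ _ two_ne_zero (by simp)]
        ring

/-- The weighted norms are eventually at least `2^((k+1)(s-m)) c`: not summable to any finite power
when `s ≥ m`, and unbounded when `s > m`. -/
theorem besovMorreyNorm_eq_top_of_lower_bound {d : ℕ} {φ₀ : EuclideanSpace ℝ (Fin d) → ℝ}
    {s m : ℝ} {q : ℝ≥0∞} (hq : 1 ≤ q) {T : 𝓢'(EuclideanSpace ℝ (Fin d), ℂ)}
    (hs : m < s ∨ (s = m ∧ q ≠ ∞)) {c : ℝ≥0∞} (hc : c ≠ 0) {K : ℕ}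
    (h : ∀ k ≥ K, c ≤ 2 ^ ((k + 1 : ℕ) * m) *
      distMorreyNorm p u (littlewoodPaleyPiece φ₀ T (k + 1))) :
    besovMorreyNorm φ₀ s u p q T = ∞ := by
  have hms : m ≤ s := by
    rcases hs with hs | hs
    · exact hs.le
    · exact hs.1.ge
  have h1 : ∀ k ≥ K, 2 ^ ((k + 1 : ℕ) * (s - m)) * c ≤ 2 ^ ((k + 1 : ℕ) * s) *
      distMorreyNorm p u (littlewoodPaleyPiece φ₀ T (k + 1)) := by
    intro k hk
    refine (mul_le_mul_right (h k hk) _).trans (le_of_eq ?_)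
    rw [← mul_assoc, ← ENNReal.rpow_add _ _ two_ne_zero (by simp)]
    congr 2
    ring
  unfold besovMorreyNorm
  split_ifs with hqt
  · have hlt : m < s := by
      rcases hs with hs | hs
      · exact hs
      · exact absurd hqt hs.2
    have hlim : Tendsto (fun k : ℕ => ((2 : ℝ≥0∞) ^ (s - m)) ^ k * c) atTop (𝓝 ∞) := by
      have h2 : (1 : ℝ≥0∞) < 2 ^ (s - m) :=
        ENNReal.one_lt_rpow (by norm_num) (by linarith)
      have h3 : Tendsto (fun k : ℕ => ((2 : ℝ≥0∞) ^ (s - m)) ^ k) atTop (𝓝 ∞) :=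
        ENNReal.tendsto_pow_atTop_nhds_top_iff.2 h2
      have h4 := ENNReal.Tendsto.mul_const (b := c) h3 (Or.inl (by simp))
      rwa [ENNReal.top_mul hc] at h4
    refine top_le_iff.1 (le_of_tendsto hlim ?_)
    filter_upwards [eventually_ge_atTop (K + 1)] with k hk
    obtain ⟨j, rfl⟩ := Nat.exists_eq_add_of_lt (show 0 < k by omega)
    rw [zero_add] at hk ⊢
    refine le_trans ?_ (le_iSup _ (j + 1))
    refine le_trans (le_of_eq ?_) (h1 j (by omega))
    rw [← ENNReal.rpow_natCast, ← ENNReal.rpow_mul, mul_comm (s - m)]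
  · have hq0 : 0 < q.toReal := ENNReal.toReal_pos (one_pos.trans_le hq).ne' hqt
    have h2 : ∑' k : ℕ, ((2 : ℝ≥0∞) ^ ((k : ℝ) * s) *
        distMorreyNorm p u (littlewoodPaleyPiece φ₀ T k)) ^ q.toReal = ∞ := by
      rw [← top_le_iff]
      calc (∞ : ℝ≥0∞) = ∑' _ : ℕ, c ^ q.toReal := by
            rw [ENNReal.tsum_const_eq_top_of_ne_zero]
            exact (ENNReal.rpow_pos_of_nonneg (pos_iff_ne_zero.2 hc) hq0.le).ne'
        _ ≤ ∑' k : ℕ, ((2 : ℝ≥0∞) ^ (((k + K + 1 : ℕ) : ℝ) * s) *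
              distMorreyNorm p u (littlewoodPaleyPiece φ₀ T (k + K + 1))) ^ q.toReal := by
            refine ENNReal.tsum_le_tsum fun k => ?_
            refine ENNReal.rpow_le_rpow (le_trans ?_ (h1 (k + K) (by omega))) hq0.le
            refine le_mul_of_one_le_left zero_le ?_
            have h3 : (0 : ℝ) ≤ (k + K + 1 : ℕ) * (s - m) :=
              mul_nonneg (by positivity) (by linarith)
            simpa using ENNReal.rpow_le_rpow_of_exponent_le (x := 2) one_le_two h3
        _ ≤ _ := ENNReal.tsum_comp_le_tsum_of_injective
            (f := fun k : ℕ => k + K + 1) (fun a b hab => by simpa using hab) _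
    rw [h2, ENNReal.top_rpow_of_pos (by positivity)]

end SmoothExample

/-! ### Scaling of the Littlewood-Paley kernels -/

section Scaling

variable {d : ℕ}

theorem fourier_comp_inv_smul (f : EuclideanSpace ℝ (Fin d) → ℂ) {a : ℝ} (ha : 0 < a)
    (ξ : EuclideanSpace ℝ (Fin d)) :
    𝓕 (fun x => f (a⁻¹ • x)) ξ = (a ^ d : ℝ) * 𝓕 f (a • ξ) := by
  rw [Real.fourier_eq', Real.fourier_eq']
  have h := Measure.integral_comp_smul volume
    (fun x : EuclideanSpace ℝ (Fin d) =>
      Complex.exp (↑(-2 * Real.pi * inner ℝ x (a • ξ)) * Complex.I) • f x) a⁻¹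
  rw [finrank_euclideanSpace_fin, inv_pow, inv_inv, abs_of_pos (by positivity)] at h
  rw [← Complex.real_smul, ← h]
  refine integral_congr_ae (ae_of_all _ fun x => ?_)
  simp only [inner_smul_left, inner_smul_right, conj_trivial]
  rw [mul_inv_cancel_left₀ ha.ne']

namespace IsDyadicGenerator

variable {φ₀ : EuclideanSpace ℝ (Fin d) → ℝ}

theorem fourier_schwartzPiece_succ (h : IsDyadicGenerator φ₀) (k : ℕ)
    (x : EuclideanSpace ℝ (Fin d)) :
    (𝓕 (h.schwartzPiece (k + 1))) x
      = (((2 ^ k) ^ d : ℝ) : ℂ) * (𝓕 (h.schwartzPiece 1)) ((2 : ℝ) ^ k • x) := by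
  have h1 : (h.schwartzPiece (k + 1) : EuclideanSpace ℝ (Fin d) → ℂ)
      = fun ξ => h.schwartzPiece 1 (((2 : ℝ) ^ k)⁻¹ • ξ) := by
    ext ξ
    simp only [schwartzPiece_apply, dyadicPiece, smul_smul]
    congr 4
    · rw [← mul_inv, ← pow_add, add_comm]
    · simp
  rw [SchwartzMap.fourier_coe, h1, fourier_comp_inv_smul _ (by positivity)]
  rfl

/-- Every piece of index at least `1` is a dilate of the first one. The sup norms of the kernels
grow like `2^(k d)` and their `L₁` norms are constant. -/
theorem exists_kernel_bounds (h : IsDyadicGenerator φ₀) :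
    ∃ A B : ℝ, 0 ≤ A ∧ 0 ≤ B ∧ ∀ k, (∀ x, ‖(𝓕 (h.schwartzPiece (k + 1))) x‖ ≤ A * (2 ^ k) ^ d) ∧
      ∫ x, ‖(𝓕 (h.schwartzPiece (k + 1))) x‖ ≤ B := by
  refine ⟨SchwartzMap.seminorm ℝ 0 0 (𝓕 (h.schwartzPiece 1)),
    ∫ x, ‖(𝓕 (h.schwartzPiece 1)) x‖, apply_nonneg _ _, integral_nonneg fun _ => norm_nonneg _,
    fun k => ⟨fun x => ?_, ?_⟩⟩
  · rw [h.fourier_schwartzPiece_succ, norm_mul, Complex.norm_real,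
      Real.norm_of_nonneg (by positivity), mul_comm]
    exact mul_le_mul_of_nonneg_right (SchwartzMap.norm_le_seminorm ℝ _ _) (by positivity)
  · refine le_of_eq ?_
    have hx : ∀ x, ‖(𝓕 (h.schwartzPiece (k + 1))) x‖
        = (2 ^ k) ^ d * ‖(𝓕 (h.schwartzPiece 1)) ((2 : ℝ) ^ k • x)‖ := fun x => by
      rw [h.fourier_schwartzPiece_succ, norm_mul, Complex.norm_real,
        Real.norm_of_nonneg (by positivity)]
    rw [integral_congr_ae (ae_of_all _ hx), integral_const_mul, Measure.integral_comp_smul volume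
      (fun x => ‖(𝓕 (h.schwartzPiece 1) : 𝓢(EuclideanSpace ℝ (Fin d), ℂ)) x‖),
      finrank_euclideanSpace_fin, abs_of_pos (by positivity), smul_eq_mul,
      mul_inv_cancel_left₀ (by positivity)]

end IsDyadicGenerator

end Scaling

/-! ### Reduction of the one-dimensional Euclidean space to the line -/

section Line

theorem integral_line {𝕜 : Type*} [RCLike 𝕜] (F : ℝ → 𝕜) :
    ∫ x : EuclideanSpace ℝ (Fin 1), F (x 0) = ∫ t, F t := by
  simpa using integral_euclidean_prod (d := 1) fun _ => F

theorem integrable_line {F : ℝ → ℂ} (hF : Integrable F) :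
    Integrable fun x : EuclideanSpace ℝ (Fin 1) => F (x 0) := by
  simpa using integrable_euclidean_prod (d := 1) fun _ => hF

theorem fourier_line (F : ℝ → ℂ) (ξ : EuclideanSpace ℝ (Fin 1)) :
    𝓕 (fun x : EuclideanSpace ℝ (Fin 1) => F (x 0)) ξ = 𝓕 F (ξ 0) := by
  simpa using fourier_euclidean_prod (d := 1) (fun _ => F) ξ

theorem norm_line (ξ : EuclideanSpace ℝ (Fin 1)) : ‖ξ‖ = |ξ 0| := by
  rw [EuclideanSpace.norm_eq]
  simp [Real.sqrt_sq_eq_abs]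

end Line

/-! ### The lacunary example for case (iii) -/

section Lacunary

variable {ε : ℝ} {g : ℝ → ℝ}

/-- The lacunary series `t ↦ ∑ⱼ 2⁻ʲ h(2ʲ t)` with `h(t) = t g(t)`, which behaves like
`t log (1 / |t|)` at the origin. -/
noncomputable def lacunary (g : ℝ → ℝ) (t : ℝ) : ℝ := ∑' j : ℕ, t * g (2 ^ j * t)

namespace IsBandLimitedProfile

theorem exists_term_le (hg : IsBandLimitedProfile ε g) : ∃ C, 0 ≤ C ∧ ∀ (j : ℕ) (t : ℝ),
    ‖t * g (2 ^ j * t)‖ ≤ C * (1 + |t|) ^ (-3 : ℝ) * (1 / 2) ^ j := by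
  obtain ⟨C, hC0, hC⟩ := hg.exists_mul_le
  refine ⟨C, hC0, fun j t => ?_⟩
  have h2 : (1 : ℝ) ≤ 2 ^ j := one_le_pow₀ one_le_two
  have h2' : (0 : ℝ) < 2 ^ j := by positivity
  rw [norm_mul, Real.norm_of_nonneg (hg.nonneg _), Real.norm_eq_abs, one_div, inv_pow,
    ← div_eq_mul_inv, le_div_iff₀ h2']
  calc |t| * g (2 ^ j * t) * 2 ^ j = |2 ^ j * t| * g (2 ^ j * t) := by
        rw [abs_mul, abs_of_pos h2']
        ring
    _ ≤ (1 + |2 ^ j * t|) * g (2 ^ j * t) :=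
        mul_le_mul_of_nonneg_right (by linarith) (hg.nonneg _)
    _ ≤ C * (1 + |2 ^ j * t|) ^ (-3 : ℝ) := hC _
    _ ≤ C * (1 + |t|) ^ (-3 : ℝ) := by
        refine mul_le_mul_of_nonneg_left ?_ hC0
        refine Real.rpow_le_rpow_of_nonpos (by positivity) ?_ (by norm_num)
        rw [abs_mul, abs_of_pos h2']
        linarith [le_mul_of_one_le_left (abs_nonneg t) h2]

theorem summable_term (hg : IsBandLimitedProfile ε g) (t : ℝ) :
    Summable fun j : ℕ => t * g (2 ^ j * t) := by
  obtain ⟨C, -, hC⟩ := hg.exists_term_le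
  exact Summable.of_norm_bounded (summable_geometric_two.mul_left _) fun j => hC j t

theorem continuous_lacunary (hg : IsBandLimitedProfile ε g) : Continuous (lacunary g) := by
  obtain ⟨C, hC0, hC⟩ := hg.exists_term_le
  refine continuous_tsum (u := fun j => C * (1 / 2) ^ j) (fun j => ?_)
    (summable_geometric_two.mul_left _) fun j t => ?_
  · exact continuous_id.mul (hg.continuous.comp (continuous_const.mul continuous_id))
  · refine (hC j t).trans (mul_le_mul_of_nonneg_right ?_ (by positivity))
    refine mul_le_of_le_one_right hC0 ?_
    exact Real.rpow_le_one_of_one_le_of_nonpos (by linarith [abs_nonneg t]) (by norm_num)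

theorem integrable_lacunary (hg : IsBandLimitedProfile ε g) : Integrable (lacunary g) := by
  obtain ⟨C, hC0, hC⟩ := hg.exists_term_le
  have h : Integrable fun t : ℝ => C * (1 + ‖t‖) ^ (-3 : ℝ) * 2 :=
    ((integrable_one_add_norm (by simp)).const_mul C).mul_const 2
  refine h.mono' hg.continuous_lacunary.aestronglyMeasurable (ae_of_all _ fun t => ?_)
  rw [← tsum_geometric_two, ← tsum_mul_left]
  exact tsum_of_norm_bounded (summable_geometric_two.mul_left _).hasSum fun j => hC j t

/-- Self-similarity: the tail of the series is a dilated copy of the whole series. -/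
theorem lacunary_eq_sum_add (hg : IsBandLimitedProfile ε g) (N : ℕ) (t : ℝ) :
    lacunary g t = ∑ j ∈ Finset.range N, t * g (2 ^ j * t)
      + (2 ^ N)⁻¹ * lacunary g (2 ^ N * t) := by
  rw [lacunary, ← (hg.summable_term t).sum_add_tsum_nat_add N, lacunary, ← tsum_mul_left]
  congr 1
  refine tsum_congr fun j => ?_
  rw [← mul_assoc, inv_mul_cancel_left₀ (by positivity), ← mul_assoc, ← pow_add]

theorem exists_lacunary_eq_mul (hg : IsBandLimitedProfile ε g) (t : ℝ) :
    lacunary g t = (∑' j : ℕ, g (2 ^ j * t)) * t ∧ 0 ≤ ∑' j : ℕ, g (2 ^ j * t) := by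
  refine ⟨?_, tsum_nonneg fun j => hg.nonneg _⟩
  rw [lacunary, tsum_mul_left, mul_comm]

/-- The series is `t` times the nonnegative weight `∑ g(2^j t)`, so `κ` acts on `t` alone and the
self-similarity survives. -/
theorem kink_lacunary_eq_sum_add (hg : IsBandLimitedProfile ε g) {b : 𝓢(ℝ, ℂ)} {κ : ℝ → ℝ}
    (hκ : IsKink b κ) (N : ℕ) (t : ℝ) :
    κ (lacunary g t) = ∑ j ∈ Finset.range N, κ t * g (2 ^ j * t)
      + (2 ^ N)⁻¹ * κ (lacunary g (2 ^ N * t)) := by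
  rcases eq_or_ne t 0 with rfl | ht
  · have h0 : κ 0 = 0 := by simpa using hκ.abs_le 0
    simp [lacunary, h0]
  obtain ⟨h1, h2⟩ := hg.exists_lacunary_eq_mul t
  obtain ⟨h3, h4⟩ := hg.exists_lacunary_eq_mul (2 ^ N * t)
  have hsum := hg.lacunary_eq_sum_add N t
  rw [h1, h3, ← Finset.mul_sum] at hsum
  have h5 : ∑' j : ℕ, g (2 ^ j * t) = ∑ j ∈ Finset.range N, g (2 ^ j * t)
      + ∑' j : ℕ, g (2 ^ j * (2 ^ N * t)) := by
    refine mul_right_cancel₀ ht ?_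
    rw [hsum]
    field_simp
  rw [h1, h3, hκ.map_mul _ _ h2, hκ.map_mul _ _ h4, hκ.map_mul _ t (by positivity), h5,
    ← Finset.mul_sum]
  generalize ∑' j : ℕ, g (2 ^ j * (2 ^ N * t)) = x
  generalize ∑ j ∈ Finset.range N, g (2 ^ j * t) = y
  field_simp

theorem fourier_term_eq_zero (hg : IsBandLimitedProfile ε g) (j : ℕ) {ξ : ℝ}
    (hξ : ε * 2 ^ j < |ξ|) : 𝓕 (fun t => ((t * g (2 ^ j * t) : ℝ) : ℂ)) ξ = 0 := by
  have h2 : (0 : ℝ) < 2 ^ j := by positivity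
  have h := fourier_comp_inv_mul (fun t => ((t * g t : ℝ) : ℂ)) (inv_pos.2 h2) ξ
  rw [hg.fourier_mul_eq_zero, mul_zero] at h
  · have h3 : (fun t => ((t * g (2 ^ j * t) : ℝ) : ℂ)) = ((2 ^ j : ℝ) : ℂ)⁻¹ •
        fun t => (((2 ^ j : ℝ)⁻¹⁻¹ * t * g ((2 ^ j : ℝ)⁻¹⁻¹ * t) : ℝ) : ℂ) := by
      ext t
      simp only [Pi.smul_apply, smul_eq_mul, inv_inv]
      push_cast
      field_simp
    rw [h3, Real.fourier_eq']
    rw [Real.fourier_eq'] at h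
    simp only [Pi.smul_apply, smul_comm _ ((2 ^ j : ℝ) : ℂ)⁻¹]
    rw [integral_smul, h, smul_zero]
  · rw [abs_mul, abs_of_pos (inv_pos.2 h2), lt_inv_mul_iff₀ h2, mul_comm]
    exact hξ

theorem integrable_term (hg : IsBandLimitedProfile ε g) (j : ℕ) :
    Integrable fun t => t * g (2 ^ j * t) := by
  have h := (hg.integrable_mul.comp_mul_left' (R := (2 : ℝ) ^ j) (by positivity)).const_mul
    ((2 : ℝ) ^ j)⁻¹
  refine h.congr (ae_of_all _ fun t => ?_)
  simp only
  rw [mul_assoc, inv_mul_cancel_left₀ (by positivity)]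

end IsBandLimitedProfile

/-- Piece `N + 1` sees only the tail, with `L₁` norm `2^(-2N) L`. The convolution is bounded by `2^N
2^(-2N)` in `L_∞` and by `2^(-2N)` in `L₁`, up to constants; interpolation gives `2^(-N (1 + 1/u))`.
-/
theorem memBesovMorrey_lacunary {p u : ℝ} (hp : 1 ≤ p) (hpu : p ≤ u)
    (hg : IsBandLimitedProfile 1 g) {φ₀ : EuclideanSpace ℝ (Fin 1) → ℝ}
    (h : IsDyadicGenerator φ₀) :
    MemBesovMorrey φ₀ (1 + 1 / u) u p ∞ fun x => lacunary g (x 0) := by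
  have hu : 1 ≤ u := hp.trans hpu
  have hu0 : 0 < u := by linarith
  have hu1 : 0 ≤ 1 - 1 / u := by
    rw [sub_nonneg, div_le_one hu0]; exact hu
  have hF : Integrable fun x : EuclideanSpace ℝ (Fin 1) => ((lacunary g (x 0) : ℝ) : ℂ) :=
    integrable_line hg.integrable_lacunary.ofReal
  obtain ⟨T, hT⟩ := exists_eq_integral hF
  refine ⟨T, represents_of_eq_integral hF hT, ?_⟩
  obtain ⟨A, B, hA0, hB0, hAB⟩ := h.exists_kernel_bounds
  set L : ℝ := ∫ t, ‖lacunary g t‖ with hL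
  have hL0 : 0 ≤ L := integral_nonneg fun _ => norm_nonneg _
  -- The factor `2^(1 + 1/u)` pays for the shift between the kernel scale `2^N` and the weight of
  -- piece `N + 1`.
  set M : ℝ≥0∞ := 2 ^ (1 + 1 / u) *
    (ENNReal.ofReal (A * L) ^ (1 - 1 / u) * ENNReal.ofReal (B * L) ^ (1 / u)) with hM
  have hMt : M < ∞ := by
    refine ENNReal.mul_lt_top ?_ (ENNReal.mul_lt_top ?_ ?_)
    · exact ENNReal.rpow_lt_top_of_nonneg (by positivity) (by simp)
    · exact ENNReal.rpow_lt_top_of_nonneg hu1 ENNReal.ofReal_ne_top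
    · exact ENNReal.rpow_lt_top_of_nonneg (by positivity) ENNReal.ofReal_ne_top
  have hbound : ∀ N : ℕ, (2 : ℝ≥0∞) ^ ((N + 1 : ℕ) * (1 + 1 / u)) *
      distMorreyNorm p u (littlewoodPaleyPiece φ₀ T (N + 1)) ≤ M := by
    intro N
    have hS : Integrable fun x : EuclideanSpace ℝ (Fin 1) =>
        ((∑ j ∈ Finset.range N, x 0 * g (2 ^ j * x 0) : ℝ) : ℂ) :=
      integrable_line (F := fun t => ((∑ j ∈ Finset.range N, t * g (2 ^ j * t) : ℝ) : ℂ))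
        (Integrable.ofReal (f := fun t => ∑ j ∈ Finset.range N, t * g (2 ^ j * t))
          (integrable_finsetSum _ fun j _ => hg.integrable_term j))
    have hR1 : Integrable fun t => (2 ^ N)⁻¹ * lacunary g (2 ^ N * t) :=
      (hg.integrable_lacunary.comp_mul_left' (R := (2 : ℝ) ^ N) (by positivity)).const_mul _
    have hR : Integrable fun x : EuclideanSpace ℝ (Fin 1) =>
        (((2 ^ N)⁻¹ * lacunary g (2 ^ N * x 0) : ℝ) : ℂ) :=
      integrable_line (F := fun t => (((2 ^ N)⁻¹ * lacunary g (2 ^ N * t) : ℝ) : ℂ)) hR1.ofReal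
    obtain ⟨TS, hTS⟩ := exists_eq_integral hS
    obtain ⟨TR, hTR⟩ := exists_eq_integral hR
    have hsplit : T = TS + TR := by
      ext φ
      have hφ : ∀ {F : EuclideanSpace ℝ (Fin 1) → ℂ}, Integrable F →
          Integrable fun x => φ x * F x := fun hF =>
        hF.bdd_mul φ.continuous.aestronglyMeasurable
          (ae_of_all _ fun x => SchwartzMap.norm_le_seminorm ℝ φ x)
      rw [add_apply, hT, hTS, hTR, ← integral_add (hφ hS) (hφ hR)]
      refine integral_congr_ae (ae_of_all _ fun x => ?_)
      simp only
      rw [← mul_add, ← Complex.ofReal_add, ← hg.lacunary_eq_sum_add]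
    -- The terms with `j < N` have frequencies `|ξ| ≤ 2^j ≤ 2^N`, where the multiplier of index `N +
    -- 1` vanishes.
    have hzero : littlewoodPaleyPiece φ₀ TS (N + 1) = 0 := by
      refine h.littlewoodPaleyPiece_eq_zero (N + 1) hS hTS fun ξ hξ => ?_
      have hξ' : 2 ^ N < |ξ 0| := by
        rw [← norm_line]
        by_contra hle
        exact hξ (h.dyadicPiece_eq_zero_of_le N (not_lt.1 hle))
      rw [fourier_line (fun t => ((∑ j ∈ Finset.range N, t * g (2 ^ j * t) : ℝ) : ℂ)),
        Real.fourier_eq']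
      simp only [Complex.ofReal_sum, smul_eq_mul, Finset.mul_sum]
      rw [integral_finsetSum]
      · refine Finset.sum_eq_zero fun j hj => ?_
        have h1 := hg.fourier_term_eq_zero j (ξ := ξ 0) (lt_of_le_of_lt ?_ hξ')
        · rw [Real.fourier_eq'] at h1
          exact h1
        · rw [one_mul]
          exact pow_le_pow_right₀ one_le_two (Finset.mem_range.1 hj).le
      · intro j _
        have h1 := (Real.fourierIntegral_convergent_iff (μ := volume)
          (f := fun t : ℝ => ((t * g (2 ^ j * t) : ℝ) : ℂ)) (ξ 0)).2 (hg.integrable_term j).ofReal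
        refine h1.congr (ae_of_all _ fun t => ?_)
        simp [Circle.smul_def, Real.fourierChar_apply, mul_assoc]
    have hpiece : littlewoodPaleyPiece φ₀ T (N + 1) = littlewoodPaleyPiece φ₀ TR (N + 1) := by
      rw [hsplit, littlewoodPaleyPiece, map_add]
      change littlewoodPaleyPiece φ₀ TS (N + 1) + littlewoodPaleyPiece φ₀ TR (N + 1) = _
      rw [hzero, zero_add]
    have hnorm : ∫ x : EuclideanSpace ℝ (Fin 1), ‖(((2 ^ N)⁻¹ * lacunary g (2 ^ N * x 0) : ℝ) : ℂ)‖
        = (2 ^ N)⁻¹ * ((2 ^ N)⁻¹ * L) := by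
      rw [integral_line (fun t => ‖(((2 ^ N)⁻¹ * lacunary g (2 ^ N * t) : ℝ) : ℂ)‖)]
      simp only [Complex.norm_real, norm_mul]
      rw [integral_const_mul, Measure.integral_comp_mul_left (fun t => ‖lacunary g t‖),
        Real.norm_of_nonneg (by positivity), abs_of_pos (by positivity), smul_eq_mul]
    have hle := distMorreyNorm_littlewoodPaleyPiece_le hp hpu h (N + 1) hR hTR (hAB N).1 (hAB N).2
    rw [hnorm, pow_one] at hle
    rw [hpiece]
    have h2N : (0 : ℝ) < 2 ^ N := by positivity
    have hx : ∀ a : ℝ, ENNReal.ofReal (a * (2 ^ N)⁻¹)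
        = ENNReal.ofReal a * (2 : ℝ≥0∞) ^ (-(N : ℝ)) := fun a => by
      rw [ENNReal.ofReal_mul' (by positivity), ENNReal.ofReal_inv_of_pos h2N, ENNReal.ofReal_pow (by positivity), ENNReal.ofReal_ofNat,
        ENNReal.rpow_neg, ENNReal.rpow_natCast]
    have e1 : A * 2 ^ N * ((2 ^ N)⁻¹ * ((2 ^ N)⁻¹ * L)) = A * L * (2 ^ N)⁻¹ := by
      field_simp
    have e2 : B * ((2 ^ N)⁻¹ * ((2 ^ N)⁻¹ * L)) = B * L * (2 ^ N)⁻¹ * (2 ^ N)⁻¹ := by ring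
    rw [e1, e2, hx, hx, hx, ENNReal.mul_rpow_of_nonneg _ _ hu1,
      ENNReal.mul_rpow_of_nonneg _ _ (by positivity), ENNReal.mul_rpow_of_nonneg _ _ (by positivity),
      ← ENNReal.rpow_mul, ← ENNReal.rpow_mul] at hle
    refine (mul_le_mul_right hle _).trans (le_of_eq ?_)
    have e3 : (2 : ℝ≥0∞) ^ (1 + 1 / u) = 2 ^ ((N + 1 : ℕ) * (1 + 1 / u)) *
        (2 ^ (-(N : ℝ) * (1 - 1 / u)) * (2 ^ (-(N : ℝ) * (1 / u)) * 2 ^ (-(N : ℝ) * (1 / u)))) := by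
      rw [← ENNReal.rpow_add _ _ two_ne_zero (by simp), ← ENNReal.rpow_add _ _ two_ne_zero (by simp),
        ← ENNReal.rpow_add _ _ two_ne_zero (by simp)]
      congr 1
      push_cast
      ring
    rw [hM, e3]
    ring
  have h0 := distMorreyNorm_littlewoodPaleyPiece_lt_top hp hpu h 0 hF hT
  unfold besovMorreyNorm
  rw [if_pos rfl]
  refine lt_of_le_of_lt (iSup_le (a := max M (distMorreyNorm p u (littlewoodPaleyPiece φ₀ T 0)))
    fun k => ?_) (max_lt hMt h0)
  cases k with
  | zero => simp
  | succ N => exact (hbound N).trans (le_max_left _ _)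

/-- A finite norm would bound the partial sums of `α (j + 1)`, whereas `α` tends to a nonzero limit.
-/
theorem not_memBesovMorrey_kink_lacunary {p u : ℝ} (hp : 1 ≤ p) (hpu : p ≤ u)
    (hg : IsBandLimitedProfile ε g) {b₀ : 𝓢(ℝ, ℂ)} {κ : ℝ → ℝ}
    (hb₀ : ∀ ξ, b₀ ξ ≠ 0 → 4 / 5 ≤ ξ ∧ ξ ≤ 9 / 10) (hκ : IsKink b₀ κ)
    {φ₀ : EuclideanSpace ℝ (Fin 1) → ℝ} (h : IsDyadicGenerator φ₀) :
    ¬ MemBesovMorrey φ₀ (1 + 1 / u) u p ∞ fun x => κ (lacunary g (x 0)) := by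
  rintro ⟨T, hT, hfin⟩
  -- With `n = 0` there are no transverse directions, so the zero profile serves as `b₁`.
  obtain ⟨A, hA0, hAt, hA⟩ := exists_test_lower_bound (n := 0) (b₁ := 0) hp hpu hb₀
    (by intro ξ hξ; simp at hξ)
  rw [besovMorreyNorm, if_pos rfl] at hfin
  set S : ℝ≥0∞ := ⨆ k : ℕ, (2 : ℝ≥0∞) ^ ((k : ℝ) * (1 + 1 / u)) *
    distMorreyNorm p u (littlewoodPaleyPiece φ₀ T k) with hS
  obtain ⟨M, hM⟩ := hg.exists_abs_le
  set α : ℕ → ℂ := fun k => ∫ t, (g ((2 ^ k)⁻¹ * t) : ℂ) * ((κ t : ℂ) * (𝓕 b₀) t) with hα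
  have hαlim : Tendsto α atTop (𝓝 (g 0 * ∫ t, (κ t : ℂ) * (𝓕 b₀) t)) :=
    tendsto_integral_dilate_mul hg.continuous hM hκ.integrable
  have hLne : (g 0 : ℂ) * ∫ t, (κ t : ℂ) * (𝓕 b₀) t ≠ 0 :=
    mul_ne_zero (Complex.ofReal_ne_zero.2 hg.pos_zero.ne') hκ.integral_ne_zero
  set c₀ : ℂ := ∫ t, (𝓕 b₀) t * ((κ (lacunary g t) : ℝ) : ℂ) with hc₀
  have hκint : Integrable fun t => ((κ (lacunary g t) : ℝ) : ℂ) := by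
    refine hg.integrable_lacunary.mono ?_ (ae_of_all _ fun t => ?_)
    · exact (Complex.continuous_ofReal.comp
        (hκ.continuous.comp hg.continuous_lacunary)).aestronglyMeasurable
    · rw [Complex.norm_real]
      exact hκ.abs_le _
  have hψint : ∀ {F : ℝ → ℂ}, Integrable F → Integrable fun t => (𝓕 b₀) t * F t := fun hF =>
    hF.bdd_mul (𝓕 b₀).continuous.aestronglyMeasurable
      (ae_of_all _ fun x => SchwartzMap.norm_le_seminorm ℝ (𝓕 b₀) x)
  have hval : ∀ (k : ℕ) (Ψ : 𝓢(EuclideanSpace ℝ (Fin 1), ℂ)),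
      (∀ x, Ψ x = prodTest (testProfiles 0 b₀ 0) (testScales 0 k k) x) →
      T Ψ = ((2 : ℂ) ^ k)⁻¹ * (∑ j ∈ Finset.range k, α (j + 1) + c₀) := by
    intro k Ψ hΨ
    have hΨ' : ∀ x, Ψ x = (((2 : ℝ) ^ k : ℝ) : ℂ) * (𝓕 b₀) (2 ^ k * x 0) := fun x => by
      rw [hΨ, prodTest_testProfiles]
      simp
    have hint : Integrable fun x => Ψ x * ((κ (lacunary g (x 0)) : ℝ) : ℂ) :=
      (integrable_line hκint).bdd_mul Ψ.continuous.aestronglyMeasurable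
        (ae_of_all _ fun x => SchwartzMap.norm_le_seminorm ℝ Ψ x)
    rw [hT.apply_eq_integral Ψ hint]
    simp_rw [hΨ']
    rw [integral_line (fun t => (((2 : ℝ) ^ k : ℝ) : ℂ) *
      (𝓕 b₀ : 𝓢(ℝ, ℂ)) (2 ^ k * t) * ((κ (lacunary g t) : ℝ) : ℂ)), integral_dilate_mul (𝓕 b₀ : 𝓢(ℝ, ℂ))
      (fun t => ((κ (lacunary g t) : ℝ) : ℂ)) (by positivity)]
    -- Unrolling `k` terms at `2^(-k) t` and reversing their order makes the `j`-th summand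
    -- independent of `k`; integration then yields partial sums of one fixed sequence.
    have hpt : ∀ t, (𝓕 b₀) t * ((κ (lacunary g ((2 ^ k)⁻¹ * t)) : ℝ) : ℂ) =
        ((2 : ℂ) ^ k)⁻¹ * (∑ j ∈ Finset.range k, (g ((2 ^ (j + 1))⁻¹ * t) : ℂ) *
          ((κ t : ℂ) * (𝓕 b₀) t) + (𝓕 b₀) t * ((κ (lacunary g t) : ℝ) : ℂ)) := by
      intro t
      rw [hg.kink_lacunary_eq_sum_add hκ k, mul_inv_cancel_left₀ (by positivity),
        hκ.map_mul _ _ (by positivity), ← Finset.sum_range_reflect, mul_add, Finset.mul_sum]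
      push_cast
      rw [mul_add, Finset.mul_sum]
      congr 1
      · refine Finset.sum_congr rfl fun j hj => ?_
        have hj' := Finset.mem_range.1 hj
        have e : (2 : ℝ) ^ (k - 1 - j) * ((2 ^ k)⁻¹ * t) = (2 ^ (j + 1))⁻¹ * t := by
          have : (2 : ℝ) ^ k = 2 ^ (k - 1 - j) * 2 ^ (j + 1) := by
            rw [← pow_add]
            congr 1
            omega
          rw [this]
          field_simp
        rw [e]
        ring
      · ring
    simp_rw [hpt]
    have hterm : ∀ j ∈ Finset.range k, Integrable fun t =>
        (g ((2 ^ (j + 1))⁻¹ * t) : ℂ) * ((κ t : ℂ) * (𝓕 b₀) t) := fun j _ => by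
      refine hκ.integrable.bdd_mul (c := M) ?_ (ae_of_all _ fun t => ?_)
      · exact (Complex.continuous_ofReal.comp
          (hg.continuous.comp (continuous_const.mul continuous_id))).aestronglyMeasurable
      · rw [Complex.norm_real]
        exact hM _
    rw [integral_const_mul, integral_add (integrable_finsetSum _ hterm) (hψint hκint),
      integral_finsetSum _ hterm]
  have hbd : ∀ k : ℕ, ‖∑ j ∈ Finset.range (k + 1), α (j + 1) + c₀‖ₑ ≤ A * S := by
    intro k
    obtain ⟨Ψ, hΨ, hΨT⟩ := hA k (k + 1) le_rfl
    have h1 := hΨT φ₀ h T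
    rw [hval (k + 1) Ψ hΨ, sub_self, zero_div, zero_add] at h1
    have h2 : (2 : ℝ≥0∞) ^ (k + 1) * ‖((2 : ℂ) ^ (k + 1))⁻¹ *
        (∑ j ∈ Finset.range (k + 1), α (j + 1) + c₀)‖ₑ
        = ‖∑ j ∈ Finset.range (k + 1), α (j + 1) + c₀‖ₑ := by
      have h3 : (2 : ℝ≥0∞) ^ (k + 1) = ‖(2 : ℂ) ^ (k + 1)‖ₑ := by
        rw [enorm_pow]
        congr 1
        simp [← ofReal_norm]
      rw [h3, ← enorm_mul, mul_inv_cancel_left₀ (pow_ne_zero _ two_ne_zero)]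
    rw [← h2]
    have h4 : (2 : ℝ≥0∞) ^ (((k + 1 : ℕ) : ℝ) * (1 + 1 / u)) *
        distMorreyNorm p u (littlewoodPaleyPiece φ₀ T (k + 1)) ≤ S := le_iSup
      (fun k : ℕ => (2 : ℝ≥0∞) ^ ((k : ℝ) * (1 + 1 / u)) *
        distMorreyNorm p u (littlewoodPaleyPiece φ₀ T k)) (k + 1)
    refine (mul_le_mul_right h1 _).trans (le_trans (le_of_eq ?_) (mul_le_mul_right h4 A))
    have h5 : (2 : ℝ≥0∞) ^ (((k + 1 : ℕ) : ℝ) * (1 + 1 / u)) = 2 ^ (k + 1) *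
        2 ^ (((k + 1 : ℕ) : ℝ) * ((0 + 1 : ℕ) / u)) := by
      rw [← ENNReal.rpow_natCast, ← ENNReal.rpow_add _ _ two_ne_zero (by simp)]
      congr 1
      push_cast
      ring
    rw [h5]
    ring
  have hASt : A * S ≠ ∞ := ENNReal.mul_ne_top hAt hfin.ne
  have hbd' : ∀ k : ℕ, ‖∑ j ∈ Finset.range (k + 1), α (j + 1)‖ ≤ (A * S).toReal + ‖c₀‖ := by
    intro k
    have h1 : ‖∑ j ∈ Finset.range (k + 1), α (j + 1) + c₀‖ ≤ (A * S).toReal := by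
      rw [← toReal_enorm]
      exact ENNReal.toReal_mono hASt (hbd k)
    have h2 := norm_sub_le (∑ j ∈ Finset.range (k + 1), α (j + 1) + c₀) c₀
    rw [add_sub_cancel_right] at h2
    linarith
  -- The Cesàro means of `α (j + 1)` have the same nonzero limit, but bounded partial sums force
  -- them to `0`.
  have hces := ((tendsto_add_atTop_iff_nat 1).2 hαlim).cesaro_smul
  have hces' := (tendsto_add_atTop_iff_nat 1).2 hces
  refine hLne (tendsto_nhds_unique hces' ?_)
  refine squeeze_zero_norm (a := fun k : ℕ => ((k : ℝ) + 1)⁻¹ * ((A * S).toReal + ‖c₀‖))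
    (fun k => ?_) ?_
  · rw [norm_smul, norm_inv, Real.norm_of_nonneg (by positivity)]
    push_cast
    exact mul_le_mul_of_nonneg_left (hbd' k) (by positivity)
  · simpa using (tendsto_one_div_add_atTop_nhds_zero_nat (𝕜 := ℝ)).mul_const
      ((A * S).toReal + ‖c₀‖)

end Lacunary

/-! ### Conclusion -/

theorem not_memBesovMorrey_kink_linearProfile {n : ℕ} {p u s : ℝ} {q : ℝ≥0∞} (hp : 1 ≤ p)
    (hpu : p ≤ u) (hq : 1 ≤ q)
    (hs : min (1 + 1 / p) (1 + (n + 1 : ℕ) / u) < s ∨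
      (s = min (1 + 1 / p) (1 + (n + 1 : ℕ) / u) ∧ q ≠ ∞))
    {g : ℝ → ℝ} (hg : IsBandLimitedProfile (1 / (10 * (n + 1))) g) {b₀ : 𝓢(ℝ, ℂ)} {κ : ℝ → ℝ}
    (hb₀ : ∀ ξ, b₀ ξ ≠ 0 → 4 / 5 ≤ ξ ∧ ξ ≤ 9 / 10) (hκ : IsKink b₀ κ)
    {φ₀ : EuclideanSpace ℝ (Fin (n + 1)) → ℝ} (h : IsDyadicGenerator φ₀) :
    ¬ MemBesovMorrey φ₀ s u p q fun x => κ (linearProfile n g x) := by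
  rintro ⟨T, hT, hfin⟩
  obtain ⟨c, hc, K, hK⟩ := exists_linearProfile_lower_bound hp hpu hb₀ hκ hg
  exact hfin.ne (besovMorreyNorm_eq_top_of_lower_bound hq hs hc (hK φ₀ h T hT))

end BesovMorrey

theorem mainTheorem4 (d : ℕ) (hd : 1 ≤ d) (p u s : ℝ) (q : ℝ≥0∞)
    (hp : 1 ≤ p) (hpu : p ≤ u) (hq : 1 ≤ q)
    (hs : min (1 + 1 / p) (1 + d / u) < s ∨
      (s = min (1 + 1 / p) (1 + d / u) ∧ q ≠ ∞) ∨
      (d = 1 ∧ s = 1 + 1 / u ∧ q = ∞)) :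
    ∃ f : EuclideanSpace ℝ (Fin d) → ℝ,
      ∀ φ₀ : EuclideanSpace ℝ (Fin d) → ℝ, BesovMorrey.IsDyadicGenerator φ₀ →
        BesovMorrey.MemBesovMorrey φ₀ s u p q f ∧
        ¬ BesovMorrey.MemBesovMorrey φ₀ s u p q (fun x => |f x|) ∧
        ¬ BesovMorrey.MemBesovMorrey φ₀ s u p q (fun x => max (f x) 0) := by
  obtain ⟨b, hb, hmax, habs⟩ := BesovMorrey.exists_isKink
  -- Cases (i) and (ii) share the band-limited example; only the endpoint `q = ∞` on the line needs
  -- the lacunary one.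
  rw [← or_assoc] at hs
  rcases hs with hs | ⟨rfl, rfl, rfl⟩
  · obtain ⟨n, rfl⟩ := Nat.exists_eq_add_of_le' hd
    obtain ⟨g, hg⟩ :=
      BesovMorrey.exists_isBandLimitedProfile (ε := 1 / (10 * ((n : ℝ) + 1))) (by positivity)
    exact ⟨BesovMorrey.linearProfile n g, fun φ₀ h =>
      ⟨BesovMorrey.memBesovMorrey_linearProfile hp hpu hq s hg h,
        BesovMorrey.not_memBesovMorrey_kink_linearProfile hp hpu hq hs hg hb habs h,
        BesovMorrey.not_memBesovMorrey_kink_linearProfile hp hpu hq hs hg hb hmax h⟩⟩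
  · obtain ⟨g, hg⟩ := BesovMorrey.exists_isBandLimitedProfile (ε := 1) one_pos
    exact ⟨fun x => BesovMorrey.lacunary g (x 0), fun φ₀ h =>
      ⟨BesovMorrey.memBesovMorrey_lacunary hp hpu hg h,
        BesovMorrey.not_memBesovMorrey_kink_lacunary hp hpu hg hb habs h,
        BesovMorrey.not_memBesovMorrey_kink_lacunary hp hpu hg hb hmax h⟩⟩
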